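/- **Theorem (Speed of convergence for lacunary Walsh series).** Let $r_0:\mathbb{R}\to\{-1,1\}$ be the $1$-periodic function with $r_0=1$ on $[0,\tfrac12)$ and $r_0=-1$ on $[\tfrac12,1)$, let $r_i(x)=r_0(2^i x)$ for $i\ge 0$, and for an integer $N=\sum_{i\ge 0}k_i2^i$ with $k_i\in\{0,1\}$ let $W_N=\prod_{i\ge 0} r_i^{k_i}$ be the $N$th Walsh function. Let $q>1$, let $(m_k)_{k\ge 1}$ be a sequence of positive integers with $m_{k+1}/m_k\ge q$ for all $k\ge 1$, and let $(a_{k,n})_{1\le k\le n}$ be a triangular array of real numbers. Put $$S_n^{W}(x)=\sum_{k=1}^n a_{k,n}W_{m_k}(x)\quad(0\le x\le 1),\qquad A_n=\Big(\sum_{k=1}^n a_{k,n}^2\Big)^{1/2},\qquad d_n=\max_{1\le k\le n}|a_{k,n}| .$$ Suppose that $A_n\to\infty$ as $n\to\infty$, and moreover that * if $q\ge 2$: $\sum_{k=1}^n a_{k,n}^4\to\kappa_4$ for some $\kappa_4<\infty$, and $n\,d_n^5\to 0$; in this case put $\gamma=\tfrac1{10}$; * if $1<q<2$: there is $\varepsilon>0$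 with $n^{1+\varepsilon}d_n^3\to 0$; in this case fix such an $\varepsilon$ and put $\gamma=\min\{\tfrac{\varepsilon}{3},\tfrac13\}$. Then there is a constant $C$, independent of $n$, such that for every $n$ with $A_n>0$ $$d_{\mathrm{Kol}}\Big(\frac{S_n^{W}}{A_n},\mathcal N(0,1)\Big)=\sup_{t\in\mathbb{R}}\left|\,\Big|\Big\{x\in[0,1]:\tfrac{S_n^{W}(x)}{A_n}\le t\Big\}\Big|-\frac1{\sqrt{2\pi}}\int_{-\infty}^t e^{-u^2/2}\,du\right|\le \frac{C}{A_n^{2\gamma+1}},$$ where $|\cdot|$ denotes Lebesgue measure. -/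

import Mathlib

open MeasureTheory ProbabilityTheory Filter Topology

noncomputable section

/-- The zeroth Rademacher function, extended with period `1` to the real line: it is `1` on
`[0, 1/2)` and `-1` on `[1/2, 1)`. -/
def rademacherZero (x : ℝ) : ℝ := if Int.fract x < 1 / 2 then 1 else -1

/-- The Rademacher functions `r_i(x) = r_0(2 ^ i x)`. -/
def rademacher (i : ℕ) (x : ℝ) : ℝ := rademacherZero (2 ^ i * x)

/-- The Walsh function `W_N`: the product of the `r_i` over the positions `i` of the digits `1`
in the dyadic expansion of `N` (so `W_0 = 1`). -/
def walsh (N : ℕ) (x : ℝ) : ℝ := ∏ i ∈ N.bitIndices.toFinset, rademacher i x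

/-- The sequence `m_1, m_2, …` of positive integers is lacunary with ratio `q`
(the value `m 0` plays no role). -/
def IsLacunary (q : ℝ) (m : ℕ → ℕ) : Prop :=
  ∀ k : ℕ, 1 ≤ k → 0 < m k ∧ q ≤ (m (k + 1) : ℝ) / (m k : ℝ)

/-- `S_n(x) = ∑_{k=1}^n a_{k,n} W_{m_k}(x)`; the entry `a_{k,n}` of the array is `a k n`. -/
def walshSum (a : ℕ → ℕ → ℝ) (m : ℕ → ℕ) (n : ℕ) (x : ℝ) : ℝ :=
  ∑ k ∈ Finset.Icc 1 n, a k n * walsh (m k) x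

/-- `A_n = (∑_{k=1}^n a_{k,n}²)^{1/2}`. -/
def arrayNorm (a : ℕ → ℕ → ℝ) (n : ℕ) : ℝ := Real.sqrt (∑ k ∈ Finset.Icc 1 n, a k n ^ 2)

/-- `d_n = max_{1 ≤ k ≤ n} |a_{k,n}|` (equal to `0` when `n = 0`). -/
def arrayMax (a : ℕ → ℕ → ℝ) (n : ℕ) : ℝ :=
  (((Finset.Icc 1 n).sup (fun k => ‖a k n‖₊) : NNReal) : ℝ)

/-- The Kolmogorov distance of two probability measures on the real line. -/
def kolmogorovDist (μ ν : Measure ℝ) : ℝ :=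
  ⨆ t : ℝ, |μ.real (Set.Iic t) - ν.real (Set.Iic t)|

/-- The law of `S_n / A_n` under Lebesgue measure on `[0, 1]`. -/
def normalizedWalshLaw (a : ℕ → ℕ → ℝ) (m : ℕ → ℕ) (n : ℕ) : Measure ℝ :=
  Measure.map (fun x => walshSum a m n x / arrayNorm a n)
    (volume.restrict (Set.Icc (0 : ℝ) 1))

/-- The exponent `γ`. -/
def walshGamma (q ε : ℝ) : ℝ := if 2 ≤ q then 1 / 10 else min (ε / 3) (1 / 3)

theorem measurable_walshSum (a : ℕ → ℕ → ℝ) (m : ℕ → ℕ) (n : ℕ) :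
    Measurable (walshSum a m n) := by
  have h0 : Measurable rademacherZero :=
    Measurable.ite (measurableSet_lt measurable_fract measurable_const)
      measurable_const measurable_const
  have h1 : ∀ i, Measurable (rademacher i) := fun i => h0.comp (measurable_const_mul _)
  have h2 : ∀ N, Measurable (walsh N) := fun N =>
    Finset.measurable_fun_prod _ (fun i _ => h1 i)
  exact Finset.measurable_fun_sum _ (fun k _ => (h2 (m k)).const_mul _)

/-- The law of `S_n / A_n` is indeed a probability measure. -/
theorem isProbabilityMeasure_normalizedWalshLaw (a : ℕ → ℕ → ℝ) (m : ℕ → ℕ) (n : ℕ) :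
    IsProbabilityMeasure (normalizedWalshLaw a m n) := by
  have : IsProbabilityMeasure (volume.restrict (Set.Icc (0 : ℝ) 1)) := ⟨by simp⟩
  exact Measure.isProbabilityMeasure_map
    ((measurable_walshSum a m n).div_const _).aemeasurable

end

/-! Under Lebesgue measure the Rademacher functions are independent fair signs, so `S_n` is a Walsh
polynomial on a discrete cube. Grouping its characters by leading binary digit gives `∑ r_i V_i`,
where `V_i` depends only on the signs before `i`. This is a martingale transform, with quadratic
variation `∑ V_i²`.

If `q ≥ 2`, different `m_k` have different leading digits, so each `|V_i|` is constant and the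
characteristic function is a product of cosines. It differs from the Gaussian one by `O(t⁴ A⁻⁴ ∑
a⁴)` times the Gaussian factor (`norm_charFun_sub_le_of_two_le`).

If `1 < q`, multiplying `exp(itS)` by `exp(t² ∑ V_i² / 2)` almost yields a martingale, because `cos
x · exp(x²/2) = 1 + O(x⁴)`. It remains to replace `∑ V_i²` by `A²`. The difference is a Walsh
polynomial over pairs `(k, l)` with a common leading digit. Lacunarity leaves boundedly many such
pairs for each leading digit of the symmetric difference (`card_symmDiff_fiber_le`), so the
difference is itself a martingale transform with bounded blocks, hence sub-Gaussian with variance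
proxy `O(n d⁴)`. This gives `exists_norm_charFun_sub_le`.

Esseen's inequality with a Gaussian kernel of width `δ = A^(-(2γ+1))` turns both estimates into
Kolmogorov bounds for large `n`. The finitely many other `n` only affect the constant. -/

/-! ### Kolmogorov distance and smoothing. -/

theorem abs_measureReal_sub_le_one (μ ν : Measure ℝ) [IsProbabilityMeasure μ]
    [IsProbabilityMeasure ν] (s : Set ℝ) : |μ.real s - ν.real s| ≤ 1 := by
  have h1 : μ.real s ≤ 1 := measureReal_le_one
  have h2 : ν.real s ≤ 1 := measureReal_le_one
  have h3 : 0 ≤ μ.real s := measureReal_nonneg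
  have h4 : 0 ≤ ν.real s := measureReal_nonneg
  rw [abs_le]; constructor <;> linarith

theorem bddAbove_kolmogorov (μ ν : Measure ℝ) [IsProbabilityMeasure μ]
    [IsProbabilityMeasure ν] :
    BddAbove (Set.range fun t : ℝ => |μ.real (Set.Iic t) - ν.real (Set.Iic t)|) :=
  ⟨1, by rintro _ ⟨t, rfl⟩; exact abs_measureReal_sub_le_one μ ν _⟩

theorem kolmogorovDist_le_one (μ ν : Measure ℝ) [IsProbabilityMeasure μ]
    [IsProbabilityMeasure ν] : kolmogorovDist μ ν ≤ 1 :=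
  ciSup_le fun _ => abs_measureReal_sub_le_one μ ν _

theorem measurable_measureReal_Iic (μ : Measure ℝ) [IsProbabilityMeasure μ] :
    Measurable fun x => μ.real (Set.Iic x) :=
  (show Monotone fun x => μ.real (Set.Iic x) from
    fun _ _ h => measureReal_mono (Set.Iic_subset_Iic.2 h)).measurable

theorem integrable_measureReal_Iic_sub (μ K : Measure ℝ) [IsProbabilityMeasure μ]
    [IsProbabilityMeasure K] (x : ℝ) : Integrable (fun z => μ.real (Set.Iic (x - z))) K := by
  refine Integrable.of_bound (C := 1)
    ((measurable_measureReal_Iic μ).comp (measurable_const.sub measurable_id)).aestronglyMeasurable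
    (ae_of_all _ fun z => ?_)
  rw [Real.norm_eq_abs, abs_of_nonneg measureReal_nonneg]
  exact measureReal_le_one

/-- If `f` is at least `c` on `[-h, h]` and at least `-D` everywhere, then its average against a
kernel concentrated on `[-h, h]` is bounded below. -/
theorem le_integral_of_le_on_Icc (K : Measure ℝ) [IsProbabilityMeasure K] {h c D : ℝ}
    (hK : 3 / 4 ≤ K.real (Set.Icc (-h) h)) {f : ℝ → ℝ} (hf : Integrable f K)
    (h1 : ∀ z ∈ Set.Icc (-h) h, c ≤ f z) (h2 : ∀ z, -D ≤ f z) (hcD : 0 ≤ c + D) :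
    3 / 4 * (c + D) - D ≤ ∫ z, f z ∂K := by
  have hint : Integrable ((Set.Icc (-h) h).indicator (fun _ : ℝ => c + D)) K :=
    (integrable_const _).indicator measurableSet_Icc
  calc 3 / 4 * (c + D) - D ≤ K.real (Set.Icc (-h) h) * (c + D) - D := by gcongr
    _ = ∫ z, ((Set.Icc (-h) h).indicator (fun _ : ℝ => c + D) z - D) ∂K := by
        rw [integral_sub hint (integrable_const _), integral_indicator measurableSet_Icc]
        simp
    _ ≤ ∫ z, f z ∂K := by
        refine integral_mono (hint.sub (integrable_const _)) hf fun z => ?_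
        by_cases hz : z ∈ Set.Icc (-h) h
        · simp only [Set.indicator_of_mem hz]
          linarith [h1 z hz]
        · simp only [Set.indicator_of_notMem hz]
          linarith [h2 z]

/-- Smoothing inequality: convolution with a probability measure concentrated near zero changes
the Kolmogorov distance to a Lipschitz distribution function by a controlled amount. -/
theorem kolmogorovDist_le_of_smoothed (μ ν K : Measure ℝ) [IsProbabilityMeasure μ]
    [IsProbabilityMeasure ν] [IsProbabilityMeasure K] {h η : ℝ}
    (hK : 3 / 4 ≤ K.real (Set.Icc (-h) h))
    (hν : ∀ x y, x ≤ y → ν.real (Set.Iic y) - ν.real (Set.Iic x) ≤ y - x)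
    (hη : ∀ x, |∫ z, μ.real (Set.Iic (x - z)) ∂K - ∫ z, ν.real (Set.Iic (x - z)) ∂K| ≤ η) :
    kolmogorovDist μ ν ≤ 2 * η + 3 * h := by
  set D := kolmogorovDist μ ν with hD
  have hle : ∀ t, |μ.real (Set.Iic t) - ν.real (Set.Iic t)| ≤ D :=
    fun t => le_ciSup (bddAbove_kolmogorov μ ν) t
  have hη0 : 0 ≤ η := (abs_nonneg _).trans (hη 0)
  have hμ : ∀ x y, x ≤ y → μ.real (Set.Iic x) ≤ μ.real (Set.Iic y) :=
    fun x y hxy => measureReal_mono (Set.Iic_subset_Iic.2 hxy)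
  have hh : 0 ≤ h := by
    by_contra hneg
    rw [Set.Icc_eq_empty (by linarith)] at hK
    norm_num at hK
  refine le_of_forall_pos_le_add fun τ hτ => ?_
  -- Near a point where the difference of distribution functions almost attains `D`, monotonicity of
  -- one and the Lipschitz bound of the other keep it above `D - τ/2 - 2h` on an interval of length
  -- `2h` to one side. Averaging over a kernel centred in that interval gives at least `D/2 - 3h/2 -
  -- 3τ/8`, which is at most `η`.
  obtain ⟨x, hx⟩ := exists_lt_of_lt_ciSup (show D - τ / 2 < ⨆ t : ℝ,
    |μ.real (Set.Iic t) - ν.real (Set.Iic t)| by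
      change _ < D; linarith)
  by_contra! hcon
  have hint := fun y => (integrable_measureReal_Iic_sub μ K y).sub
    (integrable_measureReal_Iic_sub ν K y)
  rcases le_total 0 (μ.real (Set.Iic x) - ν.real (Set.Iic x)) with h0 | h0
  · rw [abs_of_nonneg h0] at hx
    have key := le_integral_of_le_on_Icc K (c := D - τ / 2 - 2 * h) (D := D) hK (hint (x + h))
      (fun z hz => by
        have e1 := hμ x (x + h - z) (by linarith [hz.2])
        have e2 := hν x (x + h - z) (by linarith [hz.2])
        simp only [Pi.sub_apply]
        linarith [hz.1])
      (fun z => (abs_le.1 (hle (x + h - z))).1) (by linarith)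
    have e3 := (abs_le.1 (hη (x + h))).2
    rw [← integral_sub (integrable_measureReal_Iic_sub μ K _)
      (integrable_measureReal_Iic_sub ν K _)] at e3
    simp only [Pi.sub_apply] at key
    linarith
  · rw [abs_of_nonpos h0] at hx
    have key := le_integral_of_le_on_Icc K (c := D - τ / 2 - 2 * h) (D := D) hK (hint (x - h)).neg
      (fun z hz => by
        have e1 := hμ (x - h - z) x (by linarith [hz.1])
        have e2 := hν (x - h - z) x (by linarith [hz.1])
        simp only [Pi.sub_apply, Pi.neg_apply]
        linarith [hz.2])
      (fun z => by
        have := (abs_le.1 (hle (x - h - z))).2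
        simp only [Pi.sub_apply, Pi.neg_apply]
        linarith) (by linarith)
    have e3 := (abs_le.1 (hη (x - h))).1
    rw [← integral_sub (integrable_measureReal_Iic_sub μ K _)
      (integrable_measureReal_Iic_sub ν K _)] at e3
    simp only [Pi.sub_apply, Pi.neg_apply, integral_neg] at key
    linarith

/-- Both sides are the distribution function at `x` of a sum of independent variables with laws `μ`
and `K`. The swap puts the explicit Gaussian distribution function inside the integral. -/
theorem integral_measureReal_Iic_sub_comm (μ K : Measure ℝ) [IsProbabilityMeasure μ]
    [IsProbabilityMeasure K] (x : ℝ) :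
    ∫ z, μ.real (Set.Iic (x - z)) ∂K = ∫ s, K.real (Set.Iic (x - s)) ∂μ := by
  have hm : MeasurableSet {p : ℝ × ℝ | p.1 + p.2 ≤ x} :=
    measurableSet_le (measurable_fst.add measurable_snd) measurable_const
  have e1 : ∀ (μ K : Measure ℝ) [IsProbabilityMeasure μ] [IsProbabilityMeasure K],
      ∫ z, μ.real (Set.Iic (x - z)) ∂K = (K.prod μ).real {p : ℝ × ℝ | p.1 + p.2 ≤ x} := by
    intro μ K _ _
    rw [measureReal_def, Measure.prod_apply hm,
      integral_eq_lintegral_of_nonneg_ae (ae_of_all _ fun _ => measureReal_nonneg)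
        (integrable_measureReal_Iic_sub μ K x).aestronglyMeasurable]
    congr 1
    refine lintegral_congr fun z => ?_
    rw [ofReal_measureReal]
    congr 1
    ext y
    simp only [Set.mem_Iic, Set.mem_preimage, Set.mem_ofPred_eq]
    constructor <;> intro h <;> linarith
  rw [e1 μ K, e1 K μ, measureReal_def, measureReal_def, ← Measure.prod_swap,
    Measure.map_apply measurable_swap hm]
  congr 2
  ext p
  simp [add_comm]

/-! ### Gaussian distribution functions and Fourier inversion. -/

theorem hasDerivAt_gaussianReal_Iic {v : NNReal} (hv : v ≠ 0) (y : ℝ) :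
    HasDerivAt (fun x => (gaussianReal 0 v).real (Set.Iic x)) (gaussianPDFReal 0 v y) y := by
  have hint := integrable_gaussianPDFReal 0 v
  have hcont : Continuous (gaussianPDFReal 0 v) := by
    unfold gaussianPDFReal; fun_prop
  have hF : ∀ x, (gaussianReal 0 v).real (Set.Iic x) =
      (∫ t in Set.Iic (0 : ℝ), gaussianPDFReal 0 v t) + ∫ t in (0 : ℝ)..x, gaussianPDFReal 0 v t := by
    intro x
    rw [measureReal_def, gaussianReal_apply_eq_integral _ hv, ENNReal.toReal_ofReal
      (integral_nonneg fun _ => gaussianPDFReal_nonneg _ _ _),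
      ← intervalIntegral.integral_Iic_sub_Iic hint.integrableOn hint.integrableOn]
    ring
  simp_rw [hF]
  exact (intervalIntegral.integral_hasDerivAt_right (hcont.intervalIntegrable _ _)
    (hcont.stronglyMeasurableAtFilter _ _) hcont.continuousAt).const_add _

theorem gaussianPDFReal_le (v : NNReal) (x : ℝ) :
    gaussianPDFReal 0 v x ≤ (Real.sqrt (2 * Real.pi * v))⁻¹ := by
  unfold gaussianPDFReal
  refine mul_le_of_le_one_right (by positivity) (Real.exp_le_one_iff.2 ?_)
  rw [neg_div]
  have : 0 ≤ (x - 0) ^ 2 / (2 * (v : ℝ)) := by positivity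
  linarith

theorem gaussianReal_Iic_sub_le {x y : ℝ} (hxy : x ≤ y) :
    (gaussianReal 0 1).real (Set.Iic y) - (gaussianReal 0 1).real (Set.Iic x) ≤ y - x := by
  have := Convex.image_sub_le_mul_sub_of_deriv_le (f := fun x => (gaussianReal 0 1).real (Set.Iic x))
    (D := Set.univ) (C := 1) convex_univ
    (fun z _ => (hasDerivAt_gaussianReal_Iic one_ne_zero z).continuousAt.continuousWithinAt)
    (fun z _ => (hasDerivAt_gaussianReal_Iic one_ne_zero z).differentiableAt.differentiableWithinAt)
    (fun z _ => by
      rw [(hasDerivAt_gaussianReal_Iic one_ne_zero z).deriv]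
      refine (gaussianPDFReal_le 1 z).trans (inv_le_one_of_one_le₀ ?_)
      rw [Real.one_le_sqrt]
      have := Real.pi_gt_three
      simp; linarith) x trivial y trivial hxy
  simpa using this

/-- Chebyshev's inequality at two standard deviations. -/
theorem gaussianReal_Icc_ge {δ : ℝ} (hδ : 0 < δ) :
    3 / 4 ≤ (gaussianReal 0 (δ ^ 2).toNNReal).real (Set.Icc (-(2 * δ)) (2 * δ)) := by
  set K := gaussianReal 0 (δ ^ 2).toNNReal
  have h := meas_ge_le_variance_div_sq (μ := K) (X := id)
    (memLp_id_gaussianReal' 2 (by simp)) (c := 2 * δ) (by linarith)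
  have hvar : Var[id; K] = δ ^ 2 := by
    rw [variance_id_gaussianReal]; exact Real.coe_toNNReal _ (by positivity)
  have hE : ∫ x, id x ∂K = 0 := integral_id_gaussianReal
  rw [hvar, hE] at h
  have hc : K.real (Set.Icc (-(2 * δ)) (2 * δ))ᶜ ≤ 1 / 4 := by
    have h2 : K.real {ω | 2 * δ ≤ |id ω - 0|} ≤ 1 / 4 := by
      refine ENNReal.toReal_le_of_le_ofReal (by norm_num) (h.trans_eq ?_)
      congr 1; field_simp; norm_num
    refine (measureReal_mono ?_).trans h2
    intro z hz
    simp only [Set.mem_compl_iff, Set.mem_Icc, not_and_or, not_le, id, sub_zero,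
      Set.mem_ofPred_eq] at hz ⊢
    rcases hz with hz | hz
    · linarith [neg_le_abs z]
    · linarith [le_abs_self z]
  rw [measureReal_compl measurableSet_Icc] at hc
  simp only [measureReal_def, measure_univ, ENNReal.toReal_one] at hc ⊢
  linarith

theorem integral_cos_gaussianReal (v : NNReal) (y : ℝ) :
    ∫ t, Real.cos (t * y) ∂(gaussianReal 0 v) = Real.exp (-(v * y ^ 2 / 2)) := by
  have h := charFun_gaussianReal (μ := 0) (v := v) y
  rw [charFun_apply_real] at h
  have hint : Integrable (fun x : ℝ => Complex.exp (y * x * Complex.I)) (gaussianReal 0 v) :=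
    Integrable.of_bound (C := 1) (by fun_prop) (ae_of_all _ fun x => by
      rw [← Complex.ofReal_mul, Complex.norm_exp_ofReal_mul_I])
  have h2 := congrArg Complex.re h
  rw [← RCLike.re_eq_complex_re, ← integral_re hint] at h2
  have e1 : ∀ t : ℝ, RCLike.re (Complex.exp (y * t * Complex.I)) = Real.cos (t * y) := by
    intro t
    rw [← Complex.ofReal_mul, RCLike.re_eq_complex_re, Complex.exp_ofReal_mul_I_re, mul_comm]
  simp_rw [e1] at h2
  rw [h2, RCLike.re_eq_complex_re, ← Complex.exp_ofReal_re]
  congr 2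
  push_cast
  ring

theorem abs_sin_mul_div_le (t y : ℝ) : |Real.sin (t * y) / t| ≤ |y| := by
  rcases eq_or_ne t 0 with rfl | ht
  · simp
  · rw [abs_div, div_le_iff₀ (abs_pos.2 ht), mul_comm, ← abs_mul]
    exact Real.abs_sin_le_abs

theorem integrable_sin_mul_div (ρ : Measure ℝ) [IsProbabilityMeasure ρ] (y : ℝ) :
    Integrable (fun t => Real.sin (t * y) / t) ρ :=
  Integrable.of_bound (C := |y|) (Measurable.aestronglyMeasurable (by fun_prop)) (ae_of_all _ fun t => by
    rw [Real.norm_eq_abs]; exact abs_sin_mul_div_le t y)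

theorem hasDerivAt_integral_sin_mul_div {v : NNReal} (hv : v ≠ 0) (y : ℝ) :
    HasDerivAt (fun y => ∫ t, Real.sin (t * y) / t ∂(gaussianReal 0 v))
      (Real.exp (-(v * y ^ 2 / 2))) y := by
  rw [← integral_cos_gaussianReal]
  have := nullSingletonClass_gaussianReal (μ := 0) hv
  -- At `t = 0` the quotient takes the value `0` for every `y`, so its derivative is not `cos 0`;
  -- this single point is a null set.
  have hne : ∀ᵐ t ∂(gaussianReal 0 v), t ≠ 0 := by
    simp [ae_iff]
  refine (hasDerivAt_integral_of_dominated_loc_of_deriv_le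
    (F := fun y t => Real.sin (t * y) / t) (F' := fun y t => Real.cos (t * y))
    (bound := fun _ => 1) univ_mem (Eventually.of_forall fun y => Measurable.aestronglyMeasurable (by fun_prop))
    (integrable_sin_mul_div _ _) (by fun_prop)
    (ae_of_all _ fun t x _ => Real.abs_cos_le_one _) (integrable_const _) ?_).2
  filter_upwards [hne] with t ht x _
  have := ((Real.hasDerivAt_sin (t * x)).comp x ((hasDerivAt_id x).const_mul t)).div_const t
  refine this.congr_deriv ?_
  field_simp

/-- Fourier inversion for the distribution function of a centred Gaussian law. -/
theorem gaussianReal_Iic_eq {δ : ℝ} (hδ : 0 < δ) (y : ℝ) :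
    (gaussianReal 0 (δ ^ 2).toNNReal).real (Set.Iic y) =
      (gaussianReal 0 (δ ^ 2).toNNReal).real (Set.Iic 0) +
      (Real.sqrt (2 * Real.pi * δ ^ 2))⁻¹ *
        ∫ t, Real.sin (t * y) / t ∂(gaussianReal 0 ((δ ^ 2)⁻¹).toNNReal) := by
  have hv : (δ ^ 2).toNNReal ≠ 0 := (Real.toNNReal_pos.2 (by positivity)).ne'
  have hw : ((δ ^ 2)⁻¹).toNNReal ≠ 0 := (Real.toNNReal_pos.2 (by positivity)).ne'
  -- The density of variance `δ²` is, up to its normalizing constant, the characteristic function of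
  -- the Gaussian law of variance `δ⁻²`. Both terms therefore have the same derivative in `y`.
  have hd : ∀ y, HasDerivAt (fun y => (gaussianReal 0 (δ ^ 2).toNNReal).real (Set.Iic y) -
      (Real.sqrt (2 * Real.pi * δ ^ 2))⁻¹ *
        ∫ t, Real.sin (t * y) / t ∂(gaussianReal 0 ((δ ^ 2)⁻¹).toNNReal)) 0 y := by
    intro y
    refine ((hasDerivAt_gaussianReal_Iic hv y).sub
      ((hasDerivAt_integral_sin_mul_div hw y).const_mul _)).congr_deriv ?_
    rw [gaussianPDFReal, Real.coe_toNNReal _ (by positivity), Real.coe_toNNReal _ (by positivity),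
      sub_eq_zero]
    congr 2
    field_simp
    ring
  have := is_const_of_deriv_eq_zero (fun y => (hd y).differentiableAt) (fun y => (hd y).deriv) y 0
  simp only [mul_zero, Real.sin_zero, zero_div, integral_zero] at this
  linarith

theorem integral_sin_mul_sub_eq (μ : Measure ℝ) [IsProbabilityMeasure μ] (t x : ℝ) :
    ∫ s, Real.sin (t * (x - s)) ∂μ =
      (Complex.exp (t * x * Complex.I) * charFun μ (-t)).im := by
  rw [charFun_apply_real, ← integral_const_mul]
  have hint : Integrable (fun s : ℝ => Complex.exp (t * x * Complex.I) *
      Complex.exp (((-t : ℝ) : ℂ) * s * Complex.I)) μ :=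
    Integrable.of_bound (C := 1) (by fun_prop) (ae_of_all _ fun s => by
      rw [norm_mul, ← Complex.ofReal_mul, ← Complex.ofReal_mul, Complex.norm_exp_ofReal_mul_I,
        Complex.norm_exp_ofReal_mul_I, one_mul])
  rw [← RCLike.im_eq_complex_im, ← integral_im hint]
  refine integral_congr_ae (ae_of_all _ fun s => ?_)
  simp only
  rw [← Complex.exp_add, RCLike.im_eq_complex_im, ← Complex.exp_ofReal_mul_I_im]
  congr 2
  push_cast
  ring

theorem integral_gaussianReal_Iic_sub_eq (μ : Measure ℝ) [IsProbabilityMeasure μ]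
    (hμ : Integrable id μ) {δ : ℝ} (hδ : 0 < δ) (x : ℝ) :
    Integrable (fun t => (∫ s, Real.sin (t * (x - s)) ∂μ) / t)
      (gaussianReal 0 ((δ ^ 2)⁻¹).toNNReal) ∧
    ∫ s, (gaussianReal 0 (δ ^ 2).toNNReal).real (Set.Iic (x - s)) ∂μ =
      (gaussianReal 0 (δ ^ 2).toNNReal).real (Set.Iic 0) +
      (Real.sqrt (2 * Real.pi * δ ^ 2))⁻¹ *
        ∫ t, (∫ s, Real.sin (t * (x - s)) ∂μ) / t ∂(gaussianReal 0 ((δ ^ 2)⁻¹).toNNReal) := by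
  set ρ := gaussianReal 0 ((δ ^ 2)⁻¹).toNNReal
  have hprod : Integrable (Function.uncurry fun s t => Real.sin (t * (x - s)) / t) (μ.prod ρ) := by
    refine Integrable.mono' (g := fun p : ℝ × ℝ => |x - p.1|) ?_
      (Measurable.aestronglyMeasurable (by unfold Function.uncurry; fun_prop)) (ae_of_all _ fun p => ?_)
    · exact (((integrable_const x).sub hμ).abs).comp_fst ρ
    · exact abs_sin_mul_div_le _ _
  have hs : ∀ s, (gaussianReal 0 (δ ^ 2).toNNReal).real (Set.Iic (x - s)) = _ :=
    fun s => gaussianReal_Iic_eq hδ (x - s)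
  constructor
  · simpa only [integral_div, Function.uncurry] using hprod.integral_prod_right
  · have hleft : Integrable (fun s => ∫ t, Real.sin (t * (x - s)) / t ∂ρ) μ :=
      hprod.integral_prod_left
    simp_rw [hs]
    rw [integral_add (integrable_const _) (hleft.const_mul _), integral_const_mul,
      integral_integral_swap hprod]
    simp [integral_div]

/-! ### Esseen's inequality. -/

/-- Esseen's inequality with a Gaussian smoothing kernel. -/
theorem kolmogorovDist_gaussianReal_le (μ : Measure ℝ) [IsProbabilityMeasure μ]
    (hμ : Integrable id μ) {δ : ℝ} (hδ : 0 < δ) {g : ℝ → ℝ} (hg : Integrable g)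
    (h : ∀ t, ‖charFun μ t - charFun (gaussianReal 0 1) t‖ * Real.exp (-(δ ^ 2 * t ^ 2 / 2)) ≤
      |t| * g (-t)) :
    kolmogorovDist μ (gaussianReal 0 1) ≤ 1 / Real.pi * (∫ t, g t) + 6 * δ := by
  have hw : ((δ ^ 2)⁻¹).toNNReal ≠ 0 := (Real.toNNReal_pos.2 (by positivity)).ne'
  have hγ : Integrable id (gaussianReal 0 1) :=
    (memLp_id_gaussianReal 1).integrable (by simp)
  have := nullSingletonClass_gaussianReal (μ := 0) hw
  refine (kolmogorovDist_le_of_smoothed μ (gaussianReal 0 1) _ (gaussianReal_Icc_ge hδ)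
    (fun x y => gaussianReal_Iic_sub_le) (η := 1 / (2 * Real.pi) * (∫ t, g t)) fun x => ?_).trans_eq
    (by field_simp; ring)
  rw [integral_measureReal_Iic_sub_comm μ, integral_measureReal_Iic_sub_comm (gaussianReal 0 1)]
  obtain ⟨i1, e1⟩ := integral_gaussianReal_Iic_sub_eq μ hμ hδ x
  obtain ⟨i2, e2⟩ := integral_gaussianReal_Iic_sub_eq (gaussianReal 0 1) hγ hδ x
  rw [e1, e2, add_sub_add_left_eq_sub, ← mul_sub, ← integral_sub i1 i2,
    integral_gaussianReal_eq_integral_smul hw, abs_mul]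
  have hbound : |∫ t, gaussianPDFReal 0 ((δ ^ 2)⁻¹).toNNReal t •
      ((∫ s, Real.sin (t * (x - s)) ∂μ) / t -
        (∫ s, Real.sin (t * (x - s)) ∂(gaussianReal 0 1)) / t)| ≤
      ∫ t, (Real.sqrt (2 * Real.pi * (δ ^ 2)⁻¹))⁻¹ * g t := by
    rw [← Real.norm_eq_abs]
    refine norm_integral_le_of_norm_le (hg.const_mul _) ?_
    have hne : ∀ᵐ t : ℝ, t ≠ 0 := by simp [ae_iff]
    filter_upwards [hne] with t ht
    rw [integral_sin_mul_sub_eq, integral_sin_mul_sub_eq, ← sub_div, ← Complex.sub_im, ← mul_sub,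
      norm_smul, norm_div, Real.norm_eq_abs, Real.norm_eq_abs, Real.norm_eq_abs,
      abs_of_nonneg (gaussianPDFReal_nonneg _ _ _), gaussianPDFReal,
      Real.coe_toNNReal _ (by positivity), mul_assoc]
    gcongr
    rw [mul_div_assoc', div_le_iff₀ (abs_pos.2 ht)]
    have h3 := h (-t)
    rw [neg_neg, abs_neg, neg_sq] at h3
    rw [mul_comm (g t)]
    refine le_trans ?_ h3
    rw [mul_comm]
    have e3 : -(t - 0) ^ 2 / (2 * (δ ^ 2)⁻¹) = -(δ ^ 2 * t ^ 2 / 2) := by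
      field_simp; ring
    rw [e3]
    gcongr
    refine (Complex.abs_im_le_norm _).trans ?_
    rw [norm_mul, ← Complex.ofReal_mul, Complex.norm_exp_ofReal_mul_I, one_mul]
  -- The normalizing constants of the variances `δ²` and `δ⁻²` multiply to `1 / (2π)`.
  calc _ ≤ |(Real.sqrt (2 * Real.pi * δ ^ 2))⁻¹| *
        ∫ t, (Real.sqrt (2 * Real.pi * (δ ^ 2)⁻¹))⁻¹ * g t := by gcongr
    _ = _ := by
      rw [integral_const_mul, ← mul_assoc, abs_of_nonneg (by positivity), ← mul_inv,
        ← Real.sqrt_mul (by positivity)]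
      congr 2
      rw [show 2 * Real.pi * δ ^ 2 * (2 * Real.pi * (δ ^ 2)⁻¹) = (2 * Real.pi) ^ 2 by field_simp,
        Real.sqrt_sq (by positivity), one_div]

/-- Esseen's inequality when the characteristic functions are compared on `[-T, T]`. -/
theorem kolmogorovDist_gaussianReal_le_of_abs_le (μ : Measure ℝ) [IsProbabilityMeasure μ]
    (hμ : Integrable id μ) {δ T : ℝ} (hδ : 0 < δ) (hT : 0 < T) {u : ℝ → ℝ} (hu : Integrable u)
    (hu0 : ∀ t, 0 ≤ u t)
    (h : ∀ t, |t| ≤ T → ‖charFun μ t - charFun (gaussianReal 0 1) t‖ ≤ |t| * u (-t)) :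
    kolmogorovDist μ (gaussianReal 0 1) ≤
      (∫ t, u t) + 4 / (δ * T) * Real.exp (-((δ * T) ^ 2 / 4)) + 6 * δ := by
  have hb : 0 < δ ^ 2 / 4 := by positivity
  have hi := integrable_exp_neg_mul_sq hb
  have key := kolmogorovDist_gaussianReal_le μ hμ hδ
    (hu.add (hi.const_mul (2 / T * Real.exp (-((δ * T) ^ 2 / 4))))) fun t => by
      simp only [Pi.add_apply, neg_sq]
      rcases le_or_gt |t| T with ht | ht
      · calc _ ≤ ‖charFun μ t - charFun (gaussianReal 0 1) t‖ * 1 := by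
              gcongr
              rw [Real.exp_le_one_iff]
              have : 0 ≤ δ ^ 2 * t ^ 2 / 2 := by positivity
              linarith
          _ ≤ |t| * u (-t) := by rw [mul_one]; exact h t ht
          _ ≤ _ := by
              gcongr
              have : 0 ≤ 2 / T * Real.exp (-((δ * T) ^ 2 / 4)) * Real.exp (-(δ ^ 2 / 4) * t ^ 2) := by
                positivity
              linarith
      · have h1 : ‖charFun μ t - charFun (gaussianReal 0 1) t‖ ≤ 2 := by
          refine (norm_sub_le _ _).trans ?_
          have := norm_charFun_le_one (μ := μ) t
          have := norm_charFun_le_one (μ := gaussianReal 0 1) t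
          linarith
        have h2 : (δ * T) ^ 2 ≤ δ ^ 2 * t ^ 2 := by
          rw [mul_pow, ← sq_abs t]
          gcongr
        -- Half of the Gaussian exponent is spent on smallness beyond `T`, the other half on
        -- integrability in `t`.
        have h3 : Real.exp (-(δ ^ 2 * t ^ 2 / 2)) ≤
            Real.exp (-((δ * T) ^ 2 / 4)) * Real.exp (-(δ ^ 2 / 4) * t ^ 2) := by
          rw [← Real.exp_add]
          gcongr
          linarith
        have h4 : 1 ≤ |t| / T := (one_le_div hT).2 ht.le
        calc _ ≤ 2 * (Real.exp (-((δ * T) ^ 2 / 4)) * Real.exp (-(δ ^ 2 / 4) * t ^ 2)) := by gcongr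
          _ ≤ (|t| / T) * (2 * (Real.exp (-((δ * T) ^ 2 / 4)) *
              Real.exp (-(δ ^ 2 / 4) * t ^ 2))) := le_mul_of_one_le_left (by positivity) h4
          _ ≤ _ := by
              have := mul_nonneg (abs_nonneg t) (hu0 (-t))
              rw [mul_add]
              refine le_trans (le_of_eq ?_) (le_add_of_nonneg_left this)
              ring
  refine key.trans ?_
  gcongr
  have hu' : 0 ≤ ∫ t, u t := integral_nonneg hu0
  have hpi := Real.pi_gt_three
  have e : ∫ t, (u + fun t => 2 / T * Real.exp (-((δ * T) ^ 2 / 4)) *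
      Real.exp (-(δ ^ 2 / 4) * t ^ 2)) t = (∫ t, u t) + 2 / T * Real.exp (-((δ * T) ^ 2 / 4)) *
        Real.sqrt (Real.pi / (δ ^ 2 / 4)) := by
    rw [← integral_gaussian, ← integral_const_mul]
    exact integral_add hu (hi.const_mul _)
  rw [e, mul_add]
  have hs : Real.sqrt (Real.pi / (δ ^ 2 / 4)) ≤ 2 * Real.pi / δ := by
    rw [Real.sqrt_le_left (by positivity)]
    have : Real.pi ≤ Real.pi ^ 2 := by nlinarith
    calc Real.pi / (δ ^ 2 / 4) = 4 * Real.pi / δ ^ 2 := by field_simp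
      _ ≤ 4 * Real.pi ^ 2 / δ ^ 2 := by gcongr
      _ = (2 * Real.pi / δ) ^ 2 := by ring
  refine add_le_add ?_ ?_
  · rw [one_div]
    exact mul_le_of_le_one_left hu' (inv_le_one_of_one_le₀ (by linarith))
  · calc _ ≤ 1 / Real.pi * (2 / T * Real.exp (-((δ * T) ^ 2 / 4)) * (2 * Real.pi / δ)) := by
          gcongr
      _ = _ := by field_simp; ring

/-! ### Martingale transforms on the discrete cube. -/

/-- The sign attached to the coordinate `i` at the vertex `s` of the discrete cube. -/
def cubeSign (i : ℕ) (s : Finset ℕ) : ℝ := if i ∈ s then -1 else 1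

/-- The average of `f` over the vertices of the discrete cube of dimension `J`, the vertices being
identified with the subsets of `{0, …, J - 1}`. -/
noncomputable def cubeAvg {E : Type*} [AddCommGroup E] [Module ℝ E] (J : ℕ) (f : Finset ℕ → E) : E :=
  ((2 : ℝ) ^ J)⁻¹ • ∑ s ∈ (Finset.range J).powerset, f s

/-- `V j` depends on the coordinates below `j` only. -/
def CubePredictable (V : ℕ → Finset ℕ → ℝ) : Prop :=
  ∀ i j, i ≤ j → ∀ s, V i (insert j s) = V i s

/-- The martingale transform of the coordinate signs by `V`. -/
def cubeSum (V : ℕ → Finset ℕ → ℝ) (J : ℕ) (s : Finset ℕ) : ℝ :=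
  ∑ j ∈ Finset.range J, cubeSign j s * V j s

section cubeAvg

variable {E : Type*} [AddCommGroup E] [Module ℝ E]

theorem cubeAvg_zero (f : Finset ℕ → E) : cubeAvg 0 f = f ∅ := by simp [cubeAvg]

theorem cubeAvg_add (J : ℕ) (f g : Finset ℕ → E) :
    cubeAvg J (fun s => f s + g s) = cubeAvg J f + cubeAvg J g := by
  simp [cubeAvg, Finset.sum_add_distrib]

theorem cubeAvg_sub (J : ℕ) (f g : Finset ℕ → E) :
    cubeAvg J (fun s => f s - g s) = cubeAvg J f - cubeAvg J g := by
  simp [cubeAvg, Finset.sum_sub_distrib, smul_sub]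

theorem cubeAvg_smul (J : ℕ) (c : ℝ) (f : Finset ℕ → E) :
    cubeAvg J (fun s => c • f s) = c • cubeAvg J f := by
  simp [cubeAvg, ← Finset.smul_sum, smul_comm c]

theorem cubeAvg_const (J : ℕ) (c : E) : cubeAvg J (fun _ => c) = c := by
  simp only [cubeAvg, Finset.sum_const, Finset.card_powerset, Finset.card_range]
  rw [← Nat.cast_smul_eq_nsmul ℝ, smul_smul]
  simp

theorem cubeAvg_mono {J : ℕ} {f g : Finset ℕ → ℝ} (h : ∀ s, f s ≤ g s) :
    cubeAvg J f ≤ cubeAvg J g := by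
  unfold cubeAvg
  exact smul_le_smul_of_nonneg_left (Finset.sum_le_sum fun s _ => h s) (by positivity)

theorem norm_cubeAvg_le {F : Type*} [NormedAddCommGroup F] [NormedSpace ℝ F] {J : ℕ}
    {f : Finset ℕ → F} : ‖cubeAvg J f‖ ≤ cubeAvg J (fun s => ‖f s‖) := by
  unfold cubeAvg
  rw [norm_smul, Real.norm_of_nonneg (by positivity), smul_eq_mul]
  gcongr
  exact norm_sum_le _ _

theorem sq_cubeAvg_le (J : ℕ) (f : Finset ℕ → ℝ) :
    cubeAvg J f ^ 2 ≤ cubeAvg J (fun s => f s ^ 2) := by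
  have h := sq_sum_le_card_mul_sum_sq (s := (Finset.range J).powerset) (f := f)
  simp only [Finset.card_powerset, Finset.card_range, Nat.cast_pow, Nat.cast_ofNat] at h
  unfold cubeAvg
  rw [smul_eq_mul, smul_eq_mul, mul_pow]
  calc _ ≤ (((2 : ℝ) ^ J)⁻¹) ^ 2 * (2 ^ J * ∑ s ∈ (Finset.range J).powerset, f s ^ 2) := by gcongr
    _ = _ := by field_simp

/-- Averaging over the last coordinate. -/
theorem cubeAvg_succ (J : ℕ) (Φ : Finset ℕ → ℝ → E) (hΦ : ∀ s x, Φ (insert J s) x = Φ s x) :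
    cubeAvg (J + 1) (fun s => Φ s (cubeSign J s)) =
      cubeAvg J (fun s => (1 / 2 : ℝ) • (Φ s 1 + Φ s (-1))) := by
  unfold cubeAvg
  rw [Finset.range_add_one, Finset.sum_powerset_insert Finset.notMem_range_self,
    ← Finset.sum_add_distrib, ← Finset.smul_sum, smul_smul]
  congr 1
  · rw [pow_succ, mul_inv, one_div]
  · refine Finset.sum_congr rfl fun s hs => ?_
    have hJ : J ∉ s := fun h => Finset.notMem_range_self (Finset.mem_powerset.1 hs h)
    rw [hΦ]
    simp [cubeSign, hJ]

theorem cubeAvg_succ_of_forall_insert (J : ℕ) (f : Finset ℕ → E) (hf : ∀ s, f (insert J s) = f s) :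
    cubeAvg (J + 1) f = cubeAvg J f := by
  rw [cubeAvg_succ J (fun s _ => f s) fun s _ => hf s]
  congr 1
  ext s
  rw [← two_smul ℝ, smul_smul]
  simp

end cubeAvg

theorem cubeSign_insert {i j : ℕ} (h : i ≠ j) (s : Finset ℕ) :
    cubeSign i (insert j s) = cubeSign i s := by
  simp [cubeSign, h]

theorem cubeSign_sq (i : ℕ) (s : Finset ℕ) : cubeSign i s * cubeSign i s = 1 := by
  unfold cubeSign; split <;> norm_num

theorem cubeSum_succ (V : ℕ → Finset ℕ → ℝ) (J : ℕ) (s : Finset ℕ) :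
    cubeSum V (J + 1) s = cubeSum V J s + cubeSign J s * V J s := Finset.sum_range_succ _ _

theorem cubeSum_insert {V : ℕ → Finset ℕ → ℝ} (hV : CubePredictable V) (J : ℕ) (s : Finset ℕ) :
    cubeSum V J (insert J s) = cubeSum V J s := by
  refine Finset.sum_congr rfl fun j hj => ?_
  rw [Finset.mem_range] at hj
  rw [cubeSign_insert hj.ne, hV j J hj.le]

theorem cubeAvg_exp_cubeSum_succ {V : ℕ → Finset ℕ → ℝ} (hV : CubePredictable V) (l : ℝ) (J : ℕ) :
    cubeAvg (J + 1) (fun s => Real.exp (l * cubeSum V (J + 1) s)) =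
      cubeAvg J (fun s => Real.exp (l * cubeSum V J s) * Real.cosh (l * V J s)) := by
  simp_rw [cubeSum_succ]
  rw [cubeAvg_succ J (fun s x => Real.exp (l * (cubeSum V J s + x * V J s)))
    fun s x => by rw [cubeSum_insert hV, hV J J le_rfl]]
  congr 1
  ext s
  rw [Real.cosh_eq, smul_eq_mul, show l * (cubeSum V J s + 1 * V J s) =
    l * cubeSum V J s + l * V J s by ring, show l * (cubeSum V J s + -1 * V J s) =
    l * cubeSum V J s + -(l * V J s) by ring, Real.exp_add, Real.exp_add]
  ring

/-- Each integrated coordinate contributes a factor `cosh ≥ 1`; this is Jensen's inequality for a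
centred variable. -/
theorem one_le_cubeAvg_exp_cubeSum {V : ℕ → Finset ℕ → ℝ} (hV : CubePredictable V) (l : ℝ)
    (J : ℕ) : 1 ≤ cubeAvg J (fun s => Real.exp (l * cubeSum V J s)) := by
  induction J with
  | zero => simp [cubeAvg_zero, cubeSum]
  | succ J ih =>
    rw [cubeAvg_exp_cubeSum_succ hV]
    exact ih.trans (cubeAvg_mono fun s =>
      le_mul_of_one_le_right (Real.exp_pos _).le (Real.one_le_cosh _))

/-- Bounded martingale transforms of the coordinate signs are sub-Gaussian. -/
theorem cubeAvg_exp_cubeSum_le {V : ℕ → Finset ℕ → ℝ} (hV : CubePredictable V) {b : ℕ → ℝ}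
    (hb : ∀ j s, |V j s| ≤ b j) (l : ℝ) (J : ℕ) :
    cubeAvg J (fun s => Real.exp (l * cubeSum V J s)) ≤
      Real.exp (l ^ 2 * (∑ j ∈ Finset.range J, b j ^ 2) / 2) := by
  induction J with
  | zero => simp [cubeAvg_zero, cubeSum]
  | succ J ih =>
    rw [cubeAvg_exp_cubeSum_succ hV, Finset.sum_range_succ]
    have h1 : ∀ s, Real.exp (l * cubeSum V J s) * Real.cosh (l * V J s) ≤
        Real.exp (l ^ 2 * b J ^ 2 / 2) • Real.exp (l * cubeSum V J s) := fun s => by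
      rw [smul_eq_mul, mul_comm]
      gcongr
      refine (Real.cosh_le_exp_half_sq _).trans ?_
      rw [mul_pow, ← sq_abs (V J s)]
      gcongr
      exact hb J s
    refine (cubeAvg_mono h1).trans ?_
    rw [cubeAvg_smul, smul_eq_mul]
    refine (mul_le_mul_of_nonneg_left ih (Real.exp_pos _).le).trans_eq ?_
    rw [← Real.exp_add]
    ring_nf

/-- By Cauchy–Schwarz the square of the left side is at most `1 - 2 E e^Y + E e^{2Y}` with `Y = l ·
cubeSum V J`. Since `E e^Y ≥ 1`, this is at most `E e^{2Y} - 1`, and the sub-Gaussian bound applies.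
-/
theorem cubeAvg_abs_one_sub_exp_le {V : ℕ → Finset ℕ → ℝ} (hV : CubePredictable V) {b : ℕ → ℝ}
    (hb : ∀ j s, |V j s| ≤ b j) (l : ℝ) (J : ℕ) :
    cubeAvg J (fun s => |1 - Real.exp (l * cubeSum V J s)|) ≤
      Real.sqrt (Real.exp (2 * l ^ 2 * ∑ j ∈ Finset.range J, b j ^ 2) - 1) := by
  refine Real.le_sqrt_of_sq_le ((sq_cubeAvg_le _ _).trans ?_)
  have h1 := one_le_cubeAvg_exp_cubeSum hV l J
  have h2 := cubeAvg_exp_cubeSum_le hV hb (2 * l) J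
  have e : ∀ s, |1 - Real.exp (l * cubeSum V J s)| ^ 2 =
      (1 + Real.exp (2 * l * cubeSum V J s)) - (2 : ℝ) • Real.exp (l * cubeSum V J s) := fun s => by
    rw [sq_abs, smul_eq_mul, show 2 * l * cubeSum V J s = l * cubeSum V J s + l * cubeSum V J s by
      ring, Real.exp_add]
    ring
  simp_rw [e]
  rw [cubeAvg_sub, cubeAvg_add, cubeAvg_const, cubeAvg_smul, smul_eq_mul]
  have e2 : (2 * l) ^ 2 * (∑ j ∈ Finset.range J, b j ^ 2) / 2 =
    2 * l ^ 2 * ∑ j ∈ Finset.range J, b j ^ 2 := by ring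
  rw [e2] at h2
  linarith

/-! ### Characteristic functions of martingale transforms. -/

theorem abs_cos_sub_exp_le (x : ℝ) : |Real.cos x - Real.exp (-(x ^ 2 / 2))| ≤ 2 * x ^ 4 := by
  rcases le_or_gt |x| 1 with hx | hx
  · have h1 := Real.cos_bound hx
    rw [show |x| ^ 4 = x ^ 4 by rw [show (4 : ℕ) = 2 * 2 by rfl, pow_mul, sq_abs, ← pow_mul]] at h1
    have hx2 : x ^ 2 ≤ 1 := by rw [← sq_abs]; exact pow_le_one₀ (abs_nonneg x) hx
    have h2 := Real.abs_exp_sub_one_sub_id_le (x := -(x ^ 2 / 2)) (by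
      rw [abs_neg, abs_of_nonneg (by positivity)]; linarith)
    rw [abs_le] at h1 h2 ⊢
    have : 0 ≤ x ^ 4 := by positivity
    have e : (-(x ^ 2 / 2)) ^ 2 = x ^ 4 / 4 := by ring
    rw [e] at h2
    constructor <;> linarith [h1.1, h1.2, h2.1, h2.2]
  · have h1 : 1 ≤ x ^ 4 := by
      rw [← Even.pow_abs (by decide : Even 4)]
      exact one_le_pow₀ hx.le
    have h2 := Real.abs_cos_le_one x
    have h3 : Real.exp (-(x ^ 2 / 2)) ≤ 1 := by
      rw [Real.exp_le_one_iff]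
      have : 0 ≤ x ^ 2 := by positivity
      linarith
    have h4 := Real.exp_pos (-(x ^ 2 / 2))
    rw [abs_le] at h2 ⊢
    constructor <;> linarith [h2.1, h2.2]

theorem abs_cos_mul_exp_sub_one_le (x : ℝ) :
    |Real.cos x * Real.exp (x ^ 2 / 2) - 1| ≤ 2 * x ^ 4 * Real.exp (x ^ 2 / 2) := by
  have h := abs_cos_sub_exp_le x
  have e : Real.cos x * Real.exp (x ^ 2 / 2) - 1 =
      (Real.cos x - Real.exp (-(x ^ 2 / 2))) * Real.exp (x ^ 2 / 2) := by
    rw [sub_mul, ← Real.exp_add, neg_add_cancel, Real.exp_zero]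
  rw [e, abs_mul, abs_of_pos (Real.exp_pos (x ^ 2 / 2))]
  gcongr

theorem half_smul_cexp_add (c t v : ℝ) (z : ℂ) :
    (1 / 2 : ℝ) • (Complex.exp (t * (c + 1 * v : ℝ) * Complex.I + z) +
      Complex.exp (t * (c + -1 * v : ℝ) * Complex.I + z)) =
      Complex.exp (t * c * Complex.I + z) * (Real.cos (t * v) : ℂ) := by
  rw [show (t : ℂ) * (c + 1 * v : ℝ) * Complex.I + z =
      (t * c * Complex.I + z) + (t * v : ℝ) * Complex.I by push_cast; ring,
    show (t : ℂ) * (c + -1 * v : ℝ) * Complex.I + z =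
      (t * c * Complex.I + z) + -(t * v : ℝ) * Complex.I by push_cast; ring,
    Complex.exp_add _ ((t * v : ℝ) * Complex.I), Complex.exp_add _ (-(t * v : ℝ) * Complex.I),
    Complex.ofReal_cos, Complex.cos, Complex.real_smul]
  push_cast
  ring

/-- The predictable quadratic variation of `cubeSum V`. -/
def cubeVar (V : ℕ → Finset ℕ → ℝ) (J : ℕ) (s : Finset ℕ) : ℝ :=
  ∑ j ∈ Finset.range J, V j s ^ 2

theorem cubeVar_insert {V : ℕ → Finset ℕ → ℝ} (hV : CubePredictable V) {i J : ℕ} (h : i ≤ J + 1)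
    (s : Finset ℕ) : cubeVar V i (insert J s) = cubeVar V i s := by
  refine Finset.sum_congr rfl fun j hj => ?_
  rw [Finset.mem_range] at hj
  rw [hV j J (by omega)]

/-- Integrating out the last sign multiplies the compensated exponential by `cos(tV_J)
exp((tV_J)²/2) = 1 + O((tV_J)⁴)`. The errors telescope, and the weight `exp(t²/2 · cubeVar)` only
grows with `J`. -/
theorem norm_cubeAvg_cexp_compensated_sub_one_le {V : ℕ → Finset ℕ → ℝ} (hV : CubePredictable V)
    {b : ℕ → ℝ} (hb : ∀ j s, |V j s| ≤ b j) (t : ℝ) (J : ℕ) :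
    ‖cubeAvg J (fun s => Complex.exp (t * cubeSum V J s * Complex.I +
      (t ^ 2 / 2 * cubeVar V J s : ℝ))) - 1‖ ≤
      2 * t ^ 4 * (∑ j ∈ Finset.range J, b j ^ 4) *
        cubeAvg J (fun s => Real.exp (t ^ 2 / 2 * cubeVar V J s)) := by
  induction J with
  | zero => simp [cubeAvg_zero, cubeSum, cubeVar]
  | succ J ih =>
    set M : Finset ℕ → ℂ := fun s => Complex.exp (t * cubeSum V J s * Complex.I +
      (t ^ 2 / 2 * cubeVar V J s : ℝ)) with hM
    have hsucc : ∀ s, cubeVar V (J + 1) s = cubeVar V J s + V J s ^ 2 :=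
      fun s => Finset.sum_range_succ _ _
    have e1 : cubeAvg (J + 1) (fun s => Complex.exp (t * cubeSum V (J + 1) s * Complex.I +
        (t ^ 2 / 2 * cubeVar V (J + 1) s : ℝ))) =
        cubeAvg J (fun s => M s * (Real.cos (t * V J s) * Real.exp ((t * V J s) ^ 2 / 2) : ℝ)) := by
      simp_rw [cubeSum_succ]
      rw [cubeAvg_succ J (fun s x => Complex.exp (t * (cubeSum V J s + x * V J s : ℝ) * Complex.I +
        (t ^ 2 / 2 * cubeVar V (J + 1) s : ℝ))) fun s x => by
          rw [cubeSum_insert hV, hV J J le_rfl, cubeVar_insert hV le_rfl]]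
      congr 1
      ext s
      rw [half_smul_cexp_add, hM, hsucc, Complex.ofReal_mul (Real.cos _), Complex.ofReal_exp,
        mul_left_comm, ← Complex.exp_add, mul_comm]
      congr 2
      push_cast
      ring
    -- By predictability, the variation up to and including index `J` does not involve the sign of
    -- coordinate `J`.
    have e2 : cubeAvg (J + 1) (fun s => Real.exp (t ^ 2 / 2 * cubeVar V (J + 1) s)) =
        cubeAvg J (fun s => Real.exp (t ^ 2 / 2 * cubeVar V (J + 1) s)) :=
      cubeAvg_succ_of_forall_insert J _ fun s => by rw [cubeVar_insert hV le_rfl]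
    have h1 : ‖cubeAvg J (fun s => M s * (Real.cos (t * V J s) * Real.exp ((t * V J s) ^ 2 / 2) : ℝ))
        - cubeAvg J M‖ ≤ 2 * t ^ 4 * b J ^ 4 *
          cubeAvg J (fun s => Real.exp (t ^ 2 / 2 * cubeVar V (J + 1) s)) := by
      rw [← cubeAvg_sub, ← smul_eq_mul, ← cubeAvg_smul]
      refine norm_cubeAvg_le.trans (cubeAvg_mono fun s => ?_)
      have e3 : ‖M s‖ = Real.exp (t ^ 2 / 2 * cubeVar V J s) := by
        simp only [hM]
        rw [Complex.exp_add, norm_mul, ← Complex.ofReal_mul, Complex.norm_exp_ofReal_mul_I, one_mul,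
          ← Complex.ofReal_exp, Complex.norm_real, Real.norm_of_nonneg (Real.exp_pos _).le]
      have e4 : V J s ^ 4 ≤ b J ^ 4 := by
        rw [← Even.pow_abs (by decide)]
        exact pow_le_pow_left₀ (abs_nonneg _) (hb J s) 4
      rw [← mul_sub_one, norm_mul, e3, ← Complex.ofReal_one, ← Complex.ofReal_sub,
        Complex.norm_real, Real.norm_eq_abs, smul_eq_mul]
      calc _ ≤ Real.exp (t ^ 2 / 2 * cubeVar V J s) *
            (2 * (t * V J s) ^ 4 * Real.exp ((t * V J s) ^ 2 / 2)) := by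
            gcongr; exact abs_cos_mul_exp_sub_one_le _
        _ = 2 * t ^ 4 * V J s ^ 4 * Real.exp (t ^ 2 / 2 * cubeVar V (J + 1) s) := by
            rw [hsucc, show t ^ 2 / 2 * (cubeVar V J s + V J s ^ 2) =
              t ^ 2 / 2 * cubeVar V J s + (t * V J s) ^ 2 / 2 by ring, Real.exp_add]
            ring
        _ ≤ _ := by gcongr
    have h2 : cubeAvg J (fun s => Real.exp (t ^ 2 / 2 * cubeVar V J s)) ≤
        cubeAvg J (fun s => Real.exp (t ^ 2 / 2 * cubeVar V (J + 1) s)) := by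
      refine cubeAvg_mono fun s => ?_
      rw [hsucc]
      gcongr
      have : 0 ≤ V J s ^ 2 := by positivity
      linarith
    have h3 : 0 ≤ ∑ j ∈ Finset.range J, b j ^ 4 :=
      Finset.sum_nonneg fun j _ => by positivity
    rw [e1, e2, Finset.sum_range_succ]
    calc _ ≤ _ := norm_sub_le_norm_sub_add_norm_sub _ (cubeAvg J M) _
      _ ≤ _ + _ := add_le_add h1 (ih.trans (mul_le_mul_of_nonneg_left h2 (by positivity)))
      _ = _ := by ring

/-- Comparison of the characteristic function of a bounded martingale transform of the coordinate
signs with that of a Gaussian law of variance `v`. -/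
theorem norm_cubeAvg_cexp_sub_le {V : ℕ → Finset ℕ → ℝ} (hV : CubePredictable V)
    {b : ℕ → ℝ} (hb : ∀ j s, |V j s| ≤ b j) (t v : ℝ) (J : ℕ) :
    ‖cubeAvg J (fun s => Complex.exp (t * cubeSum V J s * Complex.I)) -
      (Real.exp (-(t ^ 2 / 2 * v)) : ℝ)‖ ≤
      2 * t ^ 4 * (∑ j ∈ Finset.range J, b j ^ 4) *
        cubeAvg J (fun s => Real.exp (t ^ 2 / 2 * (cubeVar V J s - v))) +
      cubeAvg J (fun s => |1 - Real.exp (t ^ 2 / 2 * (cubeVar V J s - v))|) := by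
  set M : Finset ℕ → ℂ := fun s => Complex.exp (t * cubeSum V J s * Complex.I +
      (t ^ 2 / 2 * cubeVar V J s : ℝ)) with hM
  have h1 := norm_cubeAvg_cexp_compensated_sub_one_le hV hb t J
  rw [← hM] at h1
  -- The first term is the drift of the compensated exponential, the second the cost of replacing
  -- the random variation by `v`.
  have e1 : cubeAvg J (fun s => Complex.exp (t * cubeSum V J s * Complex.I)) -
      (Real.exp (-(t ^ 2 / 2 * v)) : ℝ) = Real.exp (-(t ^ 2 / 2 * v)) • (cubeAvg J M - 1) +
        cubeAvg J (fun s => Complex.exp (t * cubeSum V J s * Complex.I) *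
          (1 - Real.exp (t ^ 2 / 2 * (cubeVar V J s - v)) : ℝ)) := by
    have : ∀ s, Complex.exp (t * cubeSum V J s * Complex.I) *
          (1 - Real.exp (t ^ 2 / 2 * (cubeVar V J s - v)) : ℝ) =
        Complex.exp (t * cubeSum V J s * Complex.I) - Real.exp (-(t ^ 2 / 2 * v)) • M s := by
      intro s
      rw [hM, Complex.ofReal_sub, Complex.ofReal_one, mul_sub, mul_one, Complex.real_smul,
        Complex.ofReal_exp, Complex.ofReal_exp, ← Complex.exp_add, ← Complex.exp_add]
      congr 2
      push_cast
      ring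
    simp_rw [this]
    rw [cubeAvg_sub, cubeAvg_smul, smul_sub, Complex.real_smul (z := 1), mul_one]
    ring
  rw [e1]
  refine (norm_add_le _ _).trans (add_le_add ?_ ?_)
  · rw [norm_smul, Real.norm_of_nonneg (Real.exp_pos _).le]
    refine (mul_le_mul_of_nonneg_left h1 (Real.exp_pos _).le).trans_eq ?_
    rw [mul_left_comm, ← smul_eq_mul (Real.exp _), ← cubeAvg_smul]
    congr 2
    ext s
    rw [smul_eq_mul, ← Real.exp_add]
    congr 1
    ring
  · refine norm_cubeAvg_le.trans (cubeAvg_mono fun s => ?_)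
    rw [norm_mul, ← Complex.ofReal_mul, Complex.norm_exp_ofReal_mul_I, one_mul, Complex.norm_real,
      Real.norm_eq_abs]

/-- If `|V j|` is deterministic, the characteristic function factorizes. -/
theorem cubeAvg_cexp_cubeSum_eq_prod {V : ℕ → Finset ℕ → ℝ} (hV : CubePredictable V) {v : ℕ → ℝ}
    (hv : ∀ j s, |V j s| = |v j|) (t : ℝ) (J : ℕ) :
    cubeAvg J (fun s => Complex.exp (t * cubeSum V J s * Complex.I)) =
      (∏ j ∈ Finset.range J, Real.cos (t * v j) : ℝ) := by
  induction J with
  | zero => simp [cubeAvg_zero, cubeSum]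
  | succ J ih =>
    simp_rw [cubeSum_succ]
    rw [cubeAvg_succ J (fun s x => Complex.exp (t * (cubeSum V J s + x * V J s : ℝ) * Complex.I))
      fun s x => by rw [cubeSum_insert hV, hV J J le_rfl], Finset.prod_range_succ, mul_comm,
      Complex.ofReal_mul, ← ih, ← Complex.real_smul, ← cubeAvg_smul]
    congr 1
    ext s
    have := half_smul_cexp_add (cubeSum V J s) t (V J s) 0
    simp only [add_zero] at this
    rw [this, mul_comm, ← Complex.real_smul, ← Real.cos_abs (t * V J s), abs_mul, hv, ← abs_mul,
      Real.cos_abs]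

/-! ### Walsh polynomials and their blocks. -/

/-- The Walsh character of the discrete cube attached to a finite set of coordinates. -/
def cubeWalsh (B s : Finset ℕ) : ℝ := ∏ i ∈ B, cubeSign i s

/-- The largest element of a finite set of natural numbers (`0` for the empty set). -/
def lead (B : Finset ℕ) : ℕ := B.sup id

theorem le_lead {B : Finset ℕ} {i : ℕ} (hi : i ∈ B) : i ≤ lead B := Finset.le_sup (f := id) hi

theorem lead_mem {B : Finset ℕ} (hB : B.Nonempty) : lead B ∈ B := by
  obtain ⟨i, hi, h⟩ := Finset.exists_mem_eq_sup B hB id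
  unfold lead
  rwa [h]

theorem lead_symmDiff_le (B C : Finset ℕ) : lead (symmDiff B C) ≤ max (lead B) (lead C) := by
  refine Finset.sup_le fun i hi => ?_
  rcases Finset.mem_symmDiff.1 hi with h | h
  · exact (le_lead h.1).trans (le_max_left _ _)
  · exact (le_lead h.1).trans (le_max_right _ _)

theorem abs_cubeWalsh (B s : Finset ℕ) : |cubeWalsh B s| = 1 := by
  unfold cubeWalsh
  rw [Finset.abs_prod]
  refine Finset.prod_eq_one fun i _ => ?_
  unfold cubeSign; split <;> simp

theorem cubeWalsh_mul (B C s : Finset ℕ) :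
    cubeWalsh B s * cubeWalsh C s = cubeWalsh (symmDiff B C) s := by
  have hB : B = B \ C ∪ B ∩ C := by ext; simp; tauto
  have hC : C = C \ B ∪ B ∩ C := by ext; simp; tauto
  have h1 : Disjoint (B \ C) (B ∩ C) := by
    rw [Finset.disjoint_left]; simp; tauto
  have h2 : Disjoint (C \ B) (B ∩ C) := by
    rw [Finset.disjoint_left]; simp; tauto
  have h3 : Disjoint (B \ C) (C \ B) := by
    rw [Finset.disjoint_left]; simp; tauto
  have e3 : symmDiff B C = B \ C ∪ C \ B := rfl
  unfold cubeWalsh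
  have e1 : ∏ i ∈ B, cubeSign i s = (∏ i ∈ B \ C, cubeSign i s) * ∏ i ∈ B ∩ C, cubeSign i s := by
    rw [← Finset.prod_union h1, ← hB]
  have e2 : ∏ i ∈ C, cubeSign i s = (∏ i ∈ C \ B, cubeSign i s) * ∏ i ∈ B ∩ C, cubeSign i s := by
    rw [← Finset.prod_union h2, ← hC]
  have e4 : (∏ i ∈ B ∩ C, cubeSign i s) * ∏ i ∈ B ∩ C, cubeSign i s = 1 := by
    rw [← Finset.prod_mul_distrib]
    exact Finset.prod_eq_one fun i _ => cubeSign_sq i s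
  rw [e1, e2, e3, Finset.prod_union h3, mul_mul_mul_comm, e4, mul_one]

theorem cubeSign_mul_cubeWalsh_erase {B : Finset ℕ} {i : ℕ} (hi : i ∈ B) (s : Finset ℕ) :
    cubeSign i s * cubeWalsh (B.erase i) s = cubeWalsh B s :=
  Finset.mul_prod_erase B (fun i => cubeSign i s) hi

section walshBlock

variable {ι : Type*} (I : Finset ι) (c : ι → ℝ) (B : ι → Finset ℕ)

/-- The Walsh polynomial `∑ p ∈ I, c p * w (B p)` is `∑ i, r_i * walshBlock I c B i`, where the
`i`th block collects the characters whose leading coordinate is `i`. -/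
def walshBlock (i : ℕ) (s : Finset ℕ) : ℝ :=
  ∑ p ∈ I with lead (B p) = i, c p * cubeWalsh ((B p).erase i) s

/-- The sum of the absolute values of the coefficients of a block. -/
def walshBlockNorm (i : ℕ) : ℝ := ∑ p ∈ I with lead (B p) = i, |c p|

theorem cubePredictable_walshBlock : CubePredictable (walshBlock I c B) := by
  intro i j hij s
  refine Finset.sum_congr rfl fun p hp => ?_
  congr 1
  refine Finset.prod_congr rfl fun k hk => cubeSign_insert ?_ s
  rw [Finset.mem_erase] at hk
  have := le_lead hk.2
  have := (Finset.mem_filter.1 hp).2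
  omega

theorem abs_walshBlock_le (i : ℕ) (s : Finset ℕ) :
    |walshBlock I c B i s| ≤ walshBlockNorm I c B i := by
  refine (Finset.abs_sum_le_sum_abs _ _).trans_eq (Finset.sum_congr rfl fun p _ => ?_)
  rw [abs_mul, abs_cubeWalsh, mul_one]

theorem walshBlockNorm_nonneg (i : ℕ) : 0 ≤ walshBlockNorm I c B i :=
  Finset.sum_nonneg fun _ _ => abs_nonneg _

variable {I c B}

theorem walshBlockNorm_le {K : ℕ} {d : ℝ} (hd : 0 ≤ d) (hc : ∀ p ∈ I, |c p| ≤ d)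
    (i : ℕ) (hK : (I.filter fun p => lead (B p) = i).card ≤ K) :
    walshBlockNorm I c B i ≤ K * d := by
  refine (Finset.sum_le_card_nsmul _ _ d fun p hp => hc p (Finset.mem_filter.1 hp).1).trans ?_
  rw [nsmul_eq_mul]
  gcongr

theorem cubeSign_mul_walshBlock (hB : ∀ p ∈ I, (B p).Nonempty) (i : ℕ) (s : Finset ℕ) :
    cubeSign i s * walshBlock I c B i s =
      ∑ p ∈ I with lead (B p) = i, c p * cubeWalsh (B p) s := by
  unfold walshBlock
  rw [Finset.mul_sum]
  refine Finset.sum_congr rfl fun p hp => ?_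
  rw [Finset.mem_filter] at hp
  rw [mul_left_comm, cubeSign_mul_cubeWalsh_erase (hp.2 ▸ lead_mem (hB p hp.1))]

theorem cubeSum_walshBlock (hB : ∀ p ∈ I, (B p).Nonempty) {J : ℕ} (hJ : ∀ p ∈ I, lead (B p) < J)
    (s : Finset ℕ) :
    cubeSum (walshBlock I c B) J s = ∑ p ∈ I, c p * cubeWalsh (B p) s := by
  unfold cubeSum
  simp_rw [cubeSign_mul_walshBlock hB]
  exact Finset.sum_fiberwise_of_maps_to (fun p hp => Finset.mem_range.2 (hJ p hp)) _

theorem sum_walshBlockNorm {J : ℕ} (hJ : ∀ p ∈ I, lead (B p) < J) :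
    ∑ i ∈ Finset.range J, walshBlockNorm I c B i = ∑ p ∈ I, |c p| :=
  Finset.sum_fiberwise_of_maps_to (fun p hp => Finset.mem_range.2 (hJ p hp)) _

/-- All but one factor of each power are bounded by `K d`; the remaining ones add up to the sum of
all `|c p|`. The bound is thus linear in the number of terms. -/
theorem sum_walshBlockNorm_pow_le {J K : ℕ} {d : ℝ} (hd : 0 ≤ d) (hJ : ∀ p ∈ I, lead (B p) < J)
    (hc : ∀ p ∈ I, |c p| ≤ d) (hK : ∀ i, (I.filter fun p => lead (B p) = i).card ≤ K) (m : ℕ) :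
    ∑ i ∈ Finset.range J, walshBlockNorm I c B i ^ (m + 1) ≤ (K * d) ^ m * (I.card * d) := by
  calc _ ≤ ∑ i ∈ Finset.range J, (K * d) ^ m * walshBlockNorm I c B i := by
        refine Finset.sum_le_sum fun i _ => ?_
        rw [pow_succ]
        have := walshBlockNorm_nonneg I c B i
        gcongr
        exact walshBlockNorm_le hd hc i (hK i)
    _ = (K * d) ^ m * ∑ p ∈ I, |c p| := by rw [← Finset.mul_sum, sum_walshBlockNorm hJ]
    _ ≤ _ := by
        gcongr
        refine (Finset.sum_le_card_nsmul _ _ d hc).trans_eq ?_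
        rw [nsmul_eq_mul]

variable [DecidableEq ι] (I c B)

/-- The off-diagonal pairs of indices with the same leading coordinate. -/
def blockPairs : Finset (ι × ι) :=
  (I ×ˢ I).filter fun z => z.1 ≠ z.2 ∧ lead (B z.1) = lead (B z.2)

variable {I c B}

/-- The fluctuation of the quadratic variation of a Walsh polynomial is again a Walsh polynomial. -/
theorem cubeVar_walshBlock (hB : ∀ p ∈ I, (B p).Nonempty) {J : ℕ} (hJ : ∀ p ∈ I, lead (B p) < J)
    (s : Finset ℕ) :
    cubeVar (walshBlock I c B) J s = ∑ p ∈ I, c p ^ 2 +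
      ∑ z ∈ blockPairs I B, c z.1 * c z.2 * cubeWalsh (symmDiff (B z.1) (B z.2)) s := by
  have e1 : ∀ i, walshBlock I c B i s ^ 2 = ∑ p ∈ I with lead (B p) = i,
      ∑ p' ∈ I with lead (B p') = lead (B p),
        c p * c p' * cubeWalsh (symmDiff (B p) (B p')) s := by
    intro i
    -- Restoring the sign of the leading coordinate leaves the square unchanged and turns erased
    -- characters back into full ones, whose products are given by symmetric differences.
    have : walshBlock I c B i s ^ 2 = (cubeSign i s * walshBlock I c B i s) ^ 2 := by
      rw [mul_pow, sq (cubeSign i s), cubeSign_sq, one_mul]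
    rw [this, cubeSign_mul_walshBlock hB, sq, Finset.sum_mul_sum]
    refine Finset.sum_congr rfl fun p hp => ?_
    rw [(Finset.mem_filter.1 hp).2]
    refine Finset.sum_congr rfl fun p' _ => ?_
    rw [← cubeWalsh_mul]
    ring
  unfold cubeVar
  simp_rw [e1]
  rw [Finset.sum_fiberwise_of_maps_to (fun p hp => Finset.mem_range.2 (hJ p hp)), blockPairs,
    Finset.sum_filter, Finset.sum_product, ← Finset.sum_add_distrib]
  refine Finset.sum_congr rfl fun p hp => ?_
  rw [Finset.sum_filter, ← Finset.sum_erase_add I _ hp, ← Finset.sum_erase_add I _ hp]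
  simp only [ne_eq, not_true_eq_false, false_and, if_false, if_true, add_zero]
  rw [add_comm]
  congr 1
  · rw [← cubeWalsh_mul, ← abs_mul_abs_self (cubeWalsh _ _), abs_cubeWalsh]
    ring
  · refine Finset.sum_congr rfl fun p' hp' => ?_
    have := (Finset.ne_of_mem_erase hp').symm
    simp [this, eq_comm]

end walshBlock

/-! ### From the unit interval to the discrete cube. -/

/-- The positions below `J` at which the Rademacher functions take the value `-1`. -/
noncomputable def rademacherSet (J : ℕ) (x : ℝ) : Finset ℕ :=
  (Finset.range J).filter fun i => rademacher i x = -1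

theorem cubeSign_rademacherSet {i J : ℕ} (h : i < J) (x : ℝ) :
    cubeSign i (rademacherSet J x) = rademacher i x := by
  unfold cubeSign rademacherSet
  simp only [Finset.mem_filter, Finset.mem_range, h, true_and]
  split_ifs with h1
  · exact h1.symm
  · unfold rademacher rademacherZero at *
    split_ifs at * with h2
    · rfl
    · exact absurd rfl h1

theorem rademacher_succ (i : ℕ) (x : ℝ) : rademacher (i + 1) x = rademacher i (2 * x) := by
  unfold rademacher
  rw [pow_succ, mul_assoc]

theorem rademacher_sub_one (i : ℕ) (x : ℝ) : rademacher i (x - 1) = rademacher i x := by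
  unfold rademacher rademacherZero
  have : Int.fract (2 ^ i * (x - 1)) = Int.fract (2 ^ i * x) := by
    rw [mul_sub, mul_one, ← Int.fract_sub_natCast (2 ^ i * x) (2 ^ i)]
    push_cast
    rfl
  rw [this]

theorem mem_rademacherSet_succ {J i : ℕ} {x : ℝ} :
    i + 1 ∈ rademacherSet (J + 1) x ↔ i ∈ rademacherSet J (2 * x) := by
  simp [rademacherSet, rademacher_succ]

/-- Doubling deletes the first binary digit and shifts the others. This self-similarity drives the
induction for uniform distribution; open intervals suffice there, as endpoints are null. -/
theorem rademacherSet_of_lt {J : ℕ} {x : ℝ} (hx : x ∈ Set.Ioo (0 : ℝ) (1 / 2)) :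
    rademacherSet (J + 1) x = (rademacherSet J (2 * x)).map (addRightEmbedding 1) := by
  have h0 : rademacher 0 x = 1 := by
    have : Int.fract x = x := Int.fract_eq_self.2 ⟨hx.1.le, by linarith [hx.2]⟩
    simp only [rademacher, rademacherZero, pow_zero, one_mul, this]
    rw [if_pos hx.2]
  ext i
  cases i with
  | zero => simp [rademacherSet, h0]; norm_num
  | succ i => rw [mem_rademacherSet_succ]; simp

theorem rademacherSet_of_gt {J : ℕ} {x : ℝ} (hx : x ∈ Set.Ioo (1 / 2 : ℝ) 1) :
    rademacherSet (J + 1) x =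
      insert 0 ((rademacherSet J (2 * x - 1)).map (addRightEmbedding 1)) := by
  have h0 : rademacher 0 x = -1 := by
    have : Int.fract x = x := Int.fract_eq_self.2 ⟨by linarith [hx.1], hx.2⟩
    simp only [rademacher, rademacherZero, pow_zero, one_mul, this]
    rw [if_neg (not_lt.2 hx.1.le)]
  have h1 : rademacherSet J (2 * x - 1) = rademacherSet J (2 * x) := by
    unfold rademacherSet
    simp_rw [rademacher_sub_one]
  ext i
  cases i with
  | zero => simp [rademacherSet, h0]
  | succ i => rw [mem_rademacherSet_succ, h1]; simp

/-- Averaging over the first coordinate. -/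
theorem cubeAvg_succ_left {E : Type*} [AddCommGroup E] [Module ℝ E] (J : ℕ) (F : Finset ℕ → E) :
    cubeAvg (J + 1) F = (1 / 2 : ℝ) • (cubeAvg J (fun s => F (s.map (addRightEmbedding 1))) +
      cubeAvg J (fun s => F (insert 0 (s.map (addRightEmbedding 1))))) := by
  have h0 : (0 : ℕ) ∉ (Finset.range J).map (addRightEmbedding 1) := by simp
  have hr : Finset.range (J + 1) = insert 0 ((Finset.range J).map (addRightEmbedding 1)) := by
    ext i
    cases i <;> simp
  have hp : ((Finset.range J).map (addRightEmbedding 1)).powerset =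
      (Finset.range J).powerset.map
        ⟨fun s => s.map (addRightEmbedding 1), Finset.map_injective _⟩ := by
    ext t
    simp only [Finset.mem_powerset, Finset.mem_map, Function.Embedding.coeFn_mk]
    rw [Finset.subset_map_iff]
    simp only [eq_comm]
  unfold cubeAvg
  rw [hr, Finset.sum_powerset_insert h0, hp, Finset.sum_map, Finset.sum_map, ← smul_add, smul_smul]
  simp only [Function.Embedding.coeFn_mk]
  congr 1
  rw [pow_succ, mul_inv, one_div, mul_comm]

/-- The signs `r_0, …, r_{J-1}` are uniformly distributed on the discrete cube. -/
theorem intervalIntegral_rademacherSet {E : Type*} [NormedAddCommGroup E] [NormedSpace ℝ E]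
    [CompleteSpace E] (J : ℕ) (F : Finset ℕ → E) :
    IntervalIntegrable (fun x => F (rademacherSet J x)) volume 0 1 ∧
      ∫ x in (0 : ℝ)..1, F (rademacherSet J x) = cubeAvg J F := by
  induction J generalizing F with
  | zero => simp [rademacherSet, cubeAvg_zero]
  | succ J ih =>
    obtain ⟨i1, e1⟩ := ih fun s => F (s.map (addRightEmbedding 1))
    obtain ⟨i2, e2⟩ := ih fun s => F (insert 0 (s.map (addRightEmbedding 1)))
    have c1 : Set.EqOn (fun x => F ((rademacherSet J (2 * x)).map (addRightEmbedding 1)))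
        (fun x => F (rademacherSet (J + 1) x)) (Set.uIoo 0 (1 / 2)) := fun x hx => by
      rw [Set.uIoo_of_le (by norm_num)] at hx
      simp only [rademacherSet_of_lt hx]
    have c2 : Set.EqOn (fun x => F (insert 0 ((rademacherSet J (2 * x - 1)).map
        (addRightEmbedding 1)))) (fun x => F (rademacherSet (J + 1) x)) (Set.uIoo (1 / 2) 1) :=
      fun x hx => by
        rw [Set.uIoo_of_le (by norm_num)] at hx
        simp only [rademacherSet_of_gt hx]
    have i1' : IntervalIntegrable (fun x => F (rademacherSet (J + 1) x)) volume 0 (1 / 2) := by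
      refine (intervalIntegrable_congr_uIoo c1).1 ?_
      simpa using i1.comp_mul_left (c := 2)
    have i2' : IntervalIntegrable (fun x => F (rademacherSet (J + 1) x)) volume (1 / 2) 1 := by
      refine (intervalIntegrable_congr_uIoo c2).1 ?_
      have := (i2.comp_sub_right 1).comp_mul_left (c := 2)
      norm_num at this
      exact this
    refine ⟨i1'.trans i2', ?_⟩
    rw [← intervalIntegral.integral_add_adjacent_intervals i1' i2',
      ← intervalIntegral.integral_congr_uIoo c1, ← intervalIntegral.integral_congr_uIoo c2,
      intervalIntegral.integral_comp_mul_left (fun x => F ((rademacherSet J x).map _)) two_ne_zero,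
      intervalIntegral.integral_comp_mul_sub (fun x => F (insert 0 ((rademacherSet J x).map _)))
        two_ne_zero, cubeAvg_succ_left, ← e1, ← e2]
    norm_num

theorem setIntegral_rademacherSet {E : Type*} [NormedAddCommGroup E] [NormedSpace ℝ E]
    [CompleteSpace E] (J : ℕ) (F : Finset ℕ → E) :
    ∫ x in Set.Icc (0 : ℝ) 1, F (rademacherSet J x) = cubeAvg J F := by
  rw [integral_Icc_eq_integral_Ioc, ← intervalIntegral.integral_of_le zero_le_one,
    (intervalIntegral_rademacherSet J F).2]

/-! ### Products of cosines. -/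

theorem cos_le_exp_neg_sq_div_two {x : ℝ} (hx : |x| ≤ 1) :
    Real.cos x ≤ Real.exp (-(x ^ 2 / 2)) := by
  have h1 := Real.cos_bound hx
  rw [Even.pow_abs (by decide : Even 4)] at h1
  have hx2 : x ^ 2 ≤ 1 := by rw [← sq_abs]; exact pow_le_one₀ (abs_nonneg x) hx
  have hx0 : 0 ≤ x ^ 2 := sq_nonneg x
  have h2 := Real.exp_bound (x := -(x ^ 2 / 2)) (n := 3) (by
    rw [abs_neg, abs_of_nonneg (by positivity)]; linarith) (by norm_num)
  rw [abs_neg, abs_of_nonneg (by positivity : 0 ≤ x ^ 2 / 2)] at h2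
  simp only [Finset.sum_range_succ, Finset.sum_range_zero, Nat.factorial, Nat.succ_eq_add_one] at h2
  norm_num at h2
  have h3 := (abs_le.1 h1).2
  have h4 := (abs_le.1 h2).1
  nlinarith [mul_nonneg hx0 hx0, mul_nonneg (mul_nonneg hx0 hx0) (sub_nonneg.2 hx2)]

/-- The bound `0 ≤ cos x ≤ exp(-x²/2)` on `[-1, 1]` lets the Gaussian factor survive the
telescoping, so the error stays integrable in `t`. The constant `4` is `2` from the fourth-order
bound times `exp(1/2) ≤ 2`. -/
theorem abs_prod_cos_sub_exp_le {x : ℕ → ℝ} (hx : ∀ i, |x i| ≤ 1) (J : ℕ) :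
    |∏ i ∈ Finset.range J, Real.cos (x i) - Real.exp (-((∑ i ∈ Finset.range J, x i ^ 2) / 2))| ≤
      4 * (∑ i ∈ Finset.range J, x i ^ 4) * Real.exp (-((∑ i ∈ Finset.range J, x i ^ 2) / 2)) := by
  induction J with
  | zero => simp
  | succ J ih =>
    rw [Finset.prod_range_succ, Finset.sum_range_succ, Finset.sum_range_succ]
    set P := ∏ i ∈ Finset.range J, Real.cos (x i)
    set Q := ∑ i ∈ Finset.range J, x i ^ 2
    set R := ∑ i ∈ Finset.range J, x i ^ 4
    have hc0 : 0 ≤ Real.cos (x J) :=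
      Real.cos_nonneg_of_neg_pi_div_two_le_of_le (by
        have := (abs_le.1 (hx J)).1; have := Real.pi_gt_three; linarith) (by
        have := (abs_le.1 (hx J)).2; have := Real.pi_gt_three; linarith)
    have hc1 := cos_le_exp_neg_sq_div_two (hx J)
    have hc2 := abs_cos_mul_exp_sub_one_le (x J)
    have hc3 : Real.exp (x J ^ 2 / 2) ≤ 2 := by
      have h1 : x J ^ 2 ≤ 1 := by rw [← sq_abs]; exact pow_le_one₀ (abs_nonneg _) (hx J)
      have h2 : Real.exp (x J ^ 2 / 2) ≤ Real.exp (1 / 2) := by gcongr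
      have h3 : Real.exp (1 / 2) ^ 2 = Real.exp 1 := by rw [← Real.exp_nat_mul]; norm_num
      have := Real.exp_one_lt_d9
      have h4 := Real.exp_pos (1 / 2)
      nlinarith
    have hexp : Real.exp (-((Q + x J ^ 2) / 2)) =
        Real.exp (-(Q / 2)) * Real.exp (-(x J ^ 2 / 2)) := by rw [← Real.exp_add]; ring_nf
    have hc4 : |Real.cos (x J) - Real.exp (-(x J ^ 2 / 2))| ≤
        4 * x J ^ 4 * Real.exp (-(x J ^ 2 / 2)) := by
      have e : Real.cos (x J) - Real.exp (-(x J ^ 2 / 2)) =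
          (Real.cos (x J) * Real.exp (x J ^ 2 / 2) - 1) * Real.exp (-(x J ^ 2 / 2)) := by
        rw [sub_mul, mul_assoc, ← Real.exp_add, add_neg_cancel, Real.exp_zero]
        ring
      rw [e, abs_mul, abs_of_pos (Real.exp_pos (-(x J ^ 2 / 2)))]
      gcongr
      refine hc2.trans ?_
      have : 0 ≤ x J ^ 4 := by positivity
      nlinarith
    rw [hexp]
    calc |P * Real.cos (x J) - Real.exp (-(Q / 2)) * Real.exp (-(x J ^ 2 / 2))|
        = |(P - Real.exp (-(Q / 2))) * Real.cos (x J) +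
            Real.exp (-(Q / 2)) * (Real.cos (x J) - Real.exp (-(x J ^ 2 / 2)))| := by ring_nf
      _ ≤ |P - Real.exp (-(Q / 2))| * Real.cos (x J) +
            Real.exp (-(Q / 2)) * |Real.cos (x J) - Real.exp (-(x J ^ 2 / 2))| := by
          refine (abs_add_le _ _).trans_eq ?_
          rw [abs_mul, abs_mul, abs_of_nonneg hc0, abs_of_pos (Real.exp_pos (-(Q / 2)))]
      _ ≤ (4 * R * Real.exp (-(Q / 2))) * Real.exp (-(x J ^ 2 / 2)) +
            Real.exp (-(Q / 2)) * (4 * x J ^ 4 * Real.exp (-(x J ^ 2 / 2))) := by gcongr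
      _ = _ := by ring

/-! ### Binary digits and counting in lacunary sequences. -/

section bits

/-- The positions of the binary digits `1`. -/
def bits (N : ℕ) : Finset ℕ := N.bitIndices.toFinset

theorem sum_two_pow_bits (N : ℕ) : ∑ i ∈ bits N, 2 ^ i = N := by
  conv_rhs => rw [← Nat.sum_map_two_pow_bitIndices N]
  exact List.sum_toFinset _ Nat.bitIndices_nodup

theorem bits_nonempty {N : ℕ} (hN : 0 < N) : (bits N).Nonempty := by
  by_contra h
  rw [Finset.not_nonempty_iff_eq_empty] at h
  have := sum_two_pow_bits N
  rw [h, Finset.sum_empty] at this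
  omega

theorem bits_injective : Function.Injective bits := fun M N h => by
  rw [← sum_two_pow_bits M, h, sum_two_pow_bits]

theorem two_pow_lead_bits_le {N : ℕ} (hN : 0 < N) : 2 ^ lead (bits N) ≤ N :=
  Nat.two_pow_le_of_mem_bitIndices (List.mem_toFinset.1 (lead_mem (bits_nonempty hN)))

theorem lt_two_pow_lead_bits (N : ℕ) : N < 2 ^ (lead (bits N) + 1) := by
  conv_lhs => rw [← sum_two_pow_bits N]
  exact Nat.geomSum_lt le_rfl fun k hk => Nat.lt_succ_of_le (le_lead hk)

/-- Common digits cancel in `M - N`, which is therefore at most the sum of `2^i` over the digits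
that differ. -/
theorem lt_add_two_pow_lead_symmDiff (M N : ℕ) :
    M < N + 2 ^ (lead (symmDiff (bits M) (bits N)) + 1) := by
  have h1 : ∑ i ∈ bits M, 2 ^ i ≤ ∑ i ∈ bits N, 2 ^ i + ∑ i ∈ symmDiff (bits M) (bits N), 2 ^ i := by
    rw [← Finset.sum_union_inter]
    refine (Finset.sum_le_sum_of_subset ?_).trans le_self_add
    intro i hi
    by_cases h : i ∈ bits N
    · exact Finset.mem_union_left _ h
    · exact Finset.mem_union_right _ (Finset.mem_symmDiff.2 (Or.inl ⟨hi, h⟩))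
  have h2 : ∑ i ∈ symmDiff (bits M) (bits N), 2 ^ i < 2 ^ (lead (symmDiff (bits M) (bits N)) + 1) :=
    Nat.geomSum_lt le_rfl fun k hk => Nat.lt_succ_of_le (le_lead hk)
  rw [sum_two_pow_bits, sum_two_pow_bits] at h1
  omega

theorem walsh_eq_cubeWalsh {N J : ℕ} (h : lead (bits N) < J) (x : ℝ) :
    walsh N x = cubeWalsh (bits N) (rademacherSet J x) :=
  Finset.prod_congr rfl fun _ hi =>
    (cubeSign_rademacherSet ((le_lead hi).trans_lt h) x).symm

end bits

namespace IsLacunary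

variable {q : ℝ} {m : ℕ → ℕ} (hm : IsLacunary q m)

include hm

theorem pow_mul_le (hq : 1 < q) {k : ℕ} (hk : 1 ≤ k) (j : ℕ) : q ^ j * m k ≤ m (k + j) := by
  induction j with
  | zero => simp
  | succ j ih =>
    obtain ⟨h1, h2⟩ := hm (k + j) (by omega)
    rw [le_div_iff₀ (by exact_mod_cast h1)] at h2
    calc q ^ (j + 1) * m k = q * (q ^ j * m k) := by ring
      _ ≤ q * m (k + j) := by gcongr
      _ ≤ _ := h2

theorem mul_le_of_lt (hq : 1 < q) {k l : ℕ} (hk : 1 ≤ k) (hkl : k < l) : q * m k ≤ m l := by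
  obtain ⟨j, rfl⟩ := Nat.exists_eq_add_of_lt hkl
  have h := hm.pow_mul_le hq hk (j + 1)
  refine le_trans ?_ h
  gcongr
  exact le_self_pow₀ hq.le (by omega)

theorem lt_of_lt (hq : 1 < q) {k l : ℕ} (hk : 1 ≤ k) (hkl : k < l) : m k < m l := by
  have h := hm.mul_le_of_lt hq hk hkl
  have h1 : (0 : ℝ) < m k := by exact_mod_cast (hm k hk).1
  exact_mod_cast (show (m k : ℝ) < m l by nlinarith)

theorem bits_ne (hq : 1 < q) {k l : ℕ} (hk : 1 ≤ k) (hl : 1 ≤ l) (hkl : k ≠ l) :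
    bits (m k) ≠ bits (m l) := by
  intro h
  have := bits_injective h
  rcases lt_or_gt_of_ne hkl with h1 | h1
  · exact absurd this (hm.lt_of_lt hq hk h1).ne
  · exact absurd this (hm.lt_of_lt hq hl h1).ne'

/-- From the smallest index in the window, `K` steps multiply the term by at least `q ^ K > c` and
leave the window. -/
theorem card_filter_le {c : ℝ} {K : ℕ} (hq : 1 < q) (hK : c < q ^ K) (n : ℕ) {x : ℝ} (hx : 0 < x) :
    ((Finset.Icc 1 n).filter fun k => x ≤ m k ∧ (m k : ℝ) ≤ c * x).card ≤ K := by
  set S := (Finset.Icc 1 n).filter fun k => x ≤ m k ∧ (m k : ℝ) ≤ c * x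
  rcases S.eq_empty_or_nonempty with h | h
  · simp [h]
  have hmin := Finset.mem_filter.1 (S.min'_mem h)
  have hsub : S ⊆ Finset.Ico (S.min' h) (S.min' h + K) := by
    intro k hk
    rw [Finset.mem_Ico]
    refine ⟨S.min'_le k hk, ?_⟩
    by_contra! hcon
    obtain ⟨j, rfl⟩ := Nat.exists_eq_add_of_le hcon
    have hk2 := (Finset.mem_filter.1 hk).2.2
    have h1 : 1 ≤ S.min' h := (Finset.mem_Icc.1 hmin.1).1
    have h2 := hm.pow_mul_le hq h1 (K + j)
    have h3 : q ^ K ≤ q ^ (K + j) := pow_le_pow_right₀ hq.le (by omega)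
    rw [← add_assoc] at h2
    have h4 : q ^ K * x ≤ q ^ (K + j) * m (S.min' h) :=
      mul_le_mul h3 hmin.2.1 hx.le (by positivity)
    nlinarith
  simpa using Finset.card_le_card hsub

theorem card_lead_fiber_le {K : ℕ} (hq : 1 < q) (hK : 2 < q ^ K) (n i : ℕ) :
    ((Finset.Icc 1 n).filter fun k => lead (bits (m k)) = i).card ≤ K := by
  refine (Finset.card_le_card fun k hk => ?_).trans
    (hm.card_filter_le hq hK n (x := 2 ^ i) (by positivity))
  rw [Finset.mem_filter] at hk ⊢
  refine ⟨hk.1, ?_⟩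
  have h1 := two_pow_lead_bits_le (hm k (Finset.mem_Icc.1 hk.1).1).1
  have h2 := lt_two_pow_lead_bits (m k)
  rw [hk.2] at h1 h2
  refine ⟨by exact_mod_cast h1, ?_⟩
  rw [pow_succ, mul_comm] at h2
  exact_mod_cast h2.le

theorem card_blockPairs_le {K : ℕ} (hq : 1 < q) (hK : 2 < q ^ K) (n : ℕ) :
    (blockPairs (Finset.Icc 1 n) fun k => bits (m k)).card ≤ n * K := by
  have h1 : ∀ k ∈ Finset.Icc 1 n, ((blockPairs (Finset.Icc 1 n) fun k => bits (m k)).filter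
      fun z => z.1 = k).card ≤ K := by
    intro k _
    refine (Finset.card_le_card_of_injOn Prod.snd (fun z hz => ?_) ?_).trans
      (hm.card_lead_fiber_le hq hK n (lead (bits (m k))))
    · simp only [blockPairs, Finset.coe_filter, Finset.mem_filter, Finset.mem_product,
        Set.mem_ofPred_eq] at hz ⊢
      rw [← hz.2]
      exact ⟨hz.1.1.2, hz.1.2.2.symm⟩
    · intro z hz w hw h
      simp only [Finset.coe_filter, Set.mem_ofPred_eq] at hz hw
      exact Prod.ext (hz.2.trans hw.2.symm) h
  have := Finset.card_le_mul_card_image_of_maps_to (f := Prod.fst)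
    (s := blockPairs (Finset.Icc 1 n) fun k => bits (m k)) (t := Finset.Icc 1 n)
    (fun z hz => (Finset.mem_product.1 (Finset.mem_filter.1 hz).1).1) K h1
  rw [Nat.card_Icc, Nat.add_sub_cancel] at this
  linarith [mul_comm n K]

/-- Two terms whose digits agree above position `i` differ by less than `2^(i+1)`, while lacunarity
makes the difference at least `q - 1` times the smaller one. Hence both are comparable with `2^i`,
and few pairs share a given `i`. -/
theorem le_of_mem_blockPairs (hq : 1 < q) {i k l : ℕ} (hk : 1 ≤ k) (hl : 1 ≤ l)
    (hkl : k ≠ l) (hlead : lead (bits (m k)) = lead (bits (m l)))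
    (hi : lead (symmDiff (bits (m k)) (bits (m l))) = i) :
    (2 : ℝ) ^ i ≤ m k ∧ (m k : ℝ) ≤ 2 * ((q - 1)⁻¹ + 1) * 2 ^ i := by
  have h0 := lead_symmDiff_le (bits (m k)) (bits (m l))
  rw [← hlead, max_self, hi] at h0
  have h1 : 2 ^ i ≤ m k :=
    (Nat.pow_le_pow_right (by norm_num) h0).trans (two_pow_lead_bits_le (hm k hk).1)
  have h2 := lt_add_two_pow_lead_symmDiff (m k) (m l)
  have h3 := lt_add_two_pow_lead_symmDiff (m l) (m k)
  rw [symmDiff_comm] at h3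
  rw [hi] at h2 h3
  have h2' : (m k : ℝ) < m l + 2 ^ (i + 1) := by exact_mod_cast h2
  have h3' : (m l : ℝ) < m k + 2 ^ (i + 1) := by exact_mod_cast h3
  rw [pow_succ] at h2' h3'
  refine ⟨by exact_mod_cast h1, ?_⟩
  have hq1 : 0 < q - 1 := by linarith
  have hmin : ∀ k l : ℕ, 1 ≤ k → k < l → (m l : ℝ) < m k + 2 ^ i * 2 →
      (m k : ℝ) ≤ (q - 1)⁻¹ * (2 ^ i * 2) := by
    intro k l hk hkl h
    rw [inv_mul_eq_div, le_div_iff₀ hq1]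
    have := hm.mul_le_of_lt hq hk hkl
    linarith
  have hp : (0 : ℝ) < 2 ^ i := by positivity
  rcases lt_or_gt_of_ne hkl with h | h
  · have := hmin k l hk h h3'
    nlinarith
  · have := hmin l k hl h h2'
    nlinarith

theorem card_symmDiff_fiber_le {K : ℕ} (hq : 1 < q) (hK : 2 * ((q - 1)⁻¹ + 1) < q ^ K) (n i : ℕ) :
    ((blockPairs (Finset.Icc 1 n) fun k => bits (m k)).filter fun z =>
      lead (symmDiff (bits (m z.1)) (bits (m z.2))) = i).card ≤ K * K := by
  have h := hm.card_filter_le hq hK n (x := 2 ^ i) (by positivity)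
  refine le_trans ?_ (Nat.mul_le_mul h h)
  rw [← Finset.card_product]
  refine Finset.card_le_card fun z hz => ?_
  simp only [blockPairs, Finset.mem_filter, Finset.mem_product, Finset.mem_Icc] at hz ⊢
  obtain ⟨⟨⟨⟨hk, hk'⟩, hl, hl'⟩, hne, hlead⟩, hi⟩ := hz
  exact ⟨⟨⟨hk, hk'⟩, hm.le_of_mem_blockPairs hq hk hl hne hlead hi⟩, ⟨hl, hl'⟩,
    hm.le_of_mem_blockPairs hq hl hk hne.symm hlead.symm (by rwa [symmDiff_comm])⟩

/-- Doubling moves a number out of its dyadic block `[2^i, 2^(i+1))`. -/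
theorem lead_bits_injOn (hq : 2 ≤ q) : Set.InjOn (fun k => lead (bits (m k))) (Set.Ici 1) := by
  have key : ∀ k l : ℕ, 1 ≤ k → k < l → lead (bits (m k)) ≠ lead (bits (m l)) := by
    intro k l hk hkl h
    have h1 := two_pow_lead_bits_le (hm k hk).1
    have h2 := lt_two_pow_lead_bits (m l)
    rw [← h] at h2
    have h3 := hm.mul_le_of_lt (by linarith) hk hkl
    have h4 : (2 : ℝ) * m k ≤ m l := by
      refine le_trans ?_ h3
      gcongr
    have h5 : 2 * m k ≤ m l := by exact_mod_cast h4
    rw [pow_succ] at h2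
    omega
  intro k hk l hl h
  by_contra hne
  rcases lt_or_gt_of_ne hne with h1 | h1
  · exact key k l hk h1 h
  · exact key l k hl h1 h.symm

end IsLacunary

/-! ### Characteristic functions of normalized Walsh sums. -/

theorem charFun_gaussianReal_zero_one (t : ℝ) :
    charFun (gaussianReal 0 1) t = (Real.exp (-(t ^ 2 / 2)) : ℝ) := by
  rw [charFun_gaussianReal]
  push_cast
  congr 1
  ring

theorem abs_le_arrayMax (a : ℕ → ℕ → ℝ) {n k : ℕ} (hk : k ∈ Finset.Icc 1 n) :
    |a k n| ≤ arrayMax a n := by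
  rw [← Real.norm_eq_abs, ← coe_nnnorm]
  exact NNReal.coe_le_coe.2 (Finset.le_sup (f := fun k => ‖a k n‖₊) hk)

theorem arrayMax_nonneg (a : ℕ → ℕ → ℝ) (n : ℕ) : 0 ≤ arrayMax a n := NNReal.coe_nonneg _

theorem arrayNorm_sq (a : ℕ → ℕ → ℝ) (n : ℕ) :
    arrayNorm a n ^ 2 = ∑ k ∈ Finset.Icc 1 n, a k n ^ 2 :=
  Real.sq_sqrt (Finset.sum_nonneg fun _ _ => sq_nonneg _)

theorem arrayNorm_sq_le (a : ℕ → ℕ → ℝ) (n : ℕ) : arrayNorm a n ^ 2 ≤ n * arrayMax a n ^ 2 := by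
  rw [arrayNorm_sq]
  refine (Finset.sum_le_card_nsmul _ _ (arrayMax a n ^ 2) fun k hk => ?_).trans_eq (by simp)
  rw [← sq_abs]
  exact pow_le_pow_left₀ (abs_nonneg _) (abs_le_arrayMax a hk) 2

theorem integrable_id_normalizedWalshLaw (a : ℕ → ℕ → ℝ) (m : ℕ → ℕ) (n : ℕ) :
    Integrable id (normalizedWalshLaw a m n) := by
  have hmeas : Measurable fun x => walshSum a m n x / arrayNorm a n :=
    (measurable_walshSum a m n).div_const _
  have : IsProbabilityMeasure (volume.restrict (Set.Icc (0 : ℝ) 1)) := ⟨by simp⟩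
  unfold normalizedWalshLaw
  rw [integrable_map_measure aestronglyMeasurable_id hmeas.aemeasurable]
  refine Integrable.of_bound (C := (∑ k ∈ Finset.Icc 1 n, |a k n|) / arrayNorm a n)
    hmeas.aestronglyMeasurable (ae_of_all _ fun x => ?_)
  have hA : 0 ≤ arrayNorm a n := Real.sqrt_nonneg _
  rw [Function.comp_apply, id, Real.norm_eq_abs, abs_div, abs_of_nonneg hA]
  refine div_le_div_of_nonneg_right ((Finset.abs_sum_le_sum_abs _ _).trans
    (Finset.sum_le_sum fun k _ => ?_)) hA
  rw [abs_mul, walsh_eq_cubeWalsh (Nat.lt_succ_self _), abs_cubeWalsh, mul_one]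

section charFun

variable {q : ℝ} {m : ℕ → ℕ}

/-- A dimension of the cube that supports the first `n` terms of the series. -/
def cubeDim (m : ℕ → ℕ) (n : ℕ) : ℕ := (Finset.Icc 1 n).sup (fun k => lead (bits (m k))) + 1

theorem lead_lt_cubeDim (m : ℕ → ℕ) {n k : ℕ} (hk : k ∈ Finset.Icc 1 n) :
    lead (bits (m k)) < cubeDim m n :=
  Nat.lt_succ_of_le (Finset.le_sup (f := fun k => lead (bits (m k))) hk)

theorem IsLacunary.bits_nonempty (hm : IsLacunary q m) {n k : ℕ} (hk : k ∈ Finset.Icc 1 n) :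
    (bits (m k)).Nonempty :=
  _root_.bits_nonempty (hm k (Finset.mem_Icc.1 hk).1).1

theorem charFun_normalizedWalshLaw (hm : IsLacunary q m) (a : ℕ → ℕ → ℝ) (n : ℕ) (t : ℝ) :
    charFun (normalizedWalshLaw a m n) t = cubeAvg (cubeDim m n) (fun s =>
      Complex.exp ((t / arrayNorm a n : ℝ) * cubeSum (walshBlock (Finset.Icc 1 n) (fun k => a k n)
        fun k => bits (m k)) (cubeDim m n) s * Complex.I)) := by
  have hmeas : Measurable fun x => walshSum a m n x / arrayNorm a n :=
    (measurable_walshSum a m n).div_const _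
  rw [charFun_apply_real, normalizedWalshLaw, integral_map hmeas.aemeasurable (by fun_prop),
    ← setIntegral_rademacherSet]
  congr 1
  ext x
  rw [cubeSum_walshBlock (fun _ hk => hm.bits_nonempty hk) fun _ hk => lead_lt_cubeDim m hk]
  have : walshSum a m n x = ∑ k ∈ Finset.Icc 1 n,
      a k n * cubeWalsh (bits (m k)) (rademacherSet (cubeDim m n) x) :=
    Finset.sum_congr rfl fun k hk => by rw [walsh_eq_cubeWalsh (lead_lt_cubeDim m hk)]
  rw [← this]
  congr 1
  push_cast
  ring

/-- For ratio at least `2` the terms are independent, and the characteristic function is a product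
of cosines. -/
theorem norm_charFun_sub_le_of_two_le (hq : 2 ≤ q) (hm : IsLacunary q m) (a : ℕ → ℕ → ℝ) {n : ℕ}
    (hA : 0 < arrayNorm a n) {t : ℝ} (ht : |t| * arrayMax a n ≤ arrayNorm a n) :
    ‖charFun (normalizedWalshLaw a m n) t - charFun (gaussianReal 0 1) t‖ ≤
      4 * (t / arrayNorm a n) ^ 4 * (∑ k ∈ Finset.Icc 1 n, a k n ^ 4) * Real.exp (-(t ^ 2 / 2)) := by
  set A := arrayNorm a n with hAdef
  set J := cubeDim m n
  set fib : ℕ → Finset ℕ := fun i => (Finset.Icc 1 n).filter fun k => lead (bits (m k)) = i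
  set v : ℕ → ℝ := fun i => ∑ k ∈ fib i, a k n with hv
  -- Each block has at most one character, so its absolute value is deterministic.
  have hfib : ∀ i, fib i = ∅ ∨ ∃ k ∈ Finset.Icc 1 n, fib i = {k} := by
    intro i
    rcases (fib i).eq_empty_or_nonempty with h | ⟨k, hk⟩
    · exact Or.inl h
    · refine Or.inr ⟨k, (Finset.mem_filter.1 hk).1, ?_⟩
      refine Finset.eq_singleton_iff_unique_mem.2 ⟨hk, fun l hl => ?_⟩
      rw [Finset.mem_filter, Finset.mem_Icc] at hk hl
      exact hm.lead_bits_injOn hq hl.1.1 hk.1.1 (hl.2.trans hk.2.symm)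
  have hVv : ∀ i s, |walshBlock (Finset.Icc 1 n) (fun k => a k n) (fun k => bits (m k)) i s| =
      |v i| := by
    intro i s
    change |∑ k ∈ fib i, a k n * cubeWalsh ((bits (m k)).erase i) s| = |∑ k ∈ fib i, a k n|
    rcases hfib i with h | ⟨k, -, h⟩
    · simp [h]
    · simp [h, abs_mul, abs_cubeWalsh]
  have hvmax : ∀ i, |v i| ≤ arrayMax a n := by
    intro i
    rcases hfib i with h | ⟨k, hk, h⟩
    · simpa [hv, h] using arrayMax_nonneg a n
    · simpa [hv, h] using abs_le_arrayMax a hk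
  have hpow : ∀ r : ℕ, r ≠ 0 → ∑ i ∈ Finset.range J, v i ^ r = ∑ k ∈ Finset.Icc 1 n, a k n ^ r := by
    intro r hr
    rw [← Finset.sum_fiberwise_of_maps_to (s := Finset.Icc 1 n) (t := Finset.range J)
      (g := fun k => lead (bits (m k))) fun k hk => Finset.mem_range.2 (lead_lt_cubeDim m hk)]
    refine Finset.sum_congr rfl fun i _ => ?_
    change (∑ k ∈ fib i, a k n) ^ r = ∑ k ∈ fib i, a k n ^ r
    rcases hfib i with h | ⟨k, -, h⟩
    · simp [h, hr]
    · simp [h]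
  have hx : ∀ i, |t / A * v i| ≤ 1 := by
    intro i
    rw [abs_mul, abs_div, abs_of_pos hA, div_mul_eq_mul_div, div_le_one hA]
    exact (mul_le_mul_of_nonneg_left (hvmax i) (abs_nonneg t)).trans ht
  have key := abs_prod_cos_sub_exp_le hx J
  have e2 : (∑ i ∈ Finset.range J, (t / A * v i) ^ 2) / 2 = t ^ 2 / 2 := by
    simp_rw [mul_pow]
    rw [← Finset.mul_sum, hpow 2 two_ne_zero, ← arrayNorm_sq, ← hAdef]
    field_simp
  have e4 : ∑ i ∈ Finset.range J, (t / A * v i) ^ 4 =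
      (t / A) ^ 4 * ∑ k ∈ Finset.Icc 1 n, a k n ^ 4 := by
    simp_rw [mul_pow _ _ 4]
    rw [← Finset.mul_sum, hpow 4 (by norm_num)]
  rw [e2, e4] at key
  rw [charFun_normalizedWalshLaw hm,
    cubeAvg_cexp_cubeSum_eq_prod (cubePredictable_walshBlock _ _ _) hVv,
    charFun_gaussianReal_zero_one, ← Complex.ofReal_sub, Complex.norm_real, Real.norm_eq_abs]
  refine key.trans_eq (by ring)

/-- The characteristic function of a normalized lacunary Walsh sum is close to the Gaussian one. -/
theorem exists_norm_charFun_sub_le (hq : 1 < q) (hm : IsLacunary q m) (a : ℕ → ℕ → ℝ) :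
    ∃ W : ℝ, 0 ≤ W ∧ ∀ n, 0 < arrayNorm a n → ∀ t : ℝ,
      (t / arrayNorm a n) ^ 4 * (W * (n * arrayMax a n ^ 4)) ≤ 1 →
      ‖charFun (normalizedWalshLaw a m n) t - charFun (gaussianReal 0 1) t‖ ≤
        5 * (t / arrayNorm a n) ^ 2 * Real.sqrt (W * (n * arrayMax a n ^ 4)) := by
  obtain ⟨K, hK⟩ := pow_unbounded_of_one_lt (2 * ((q - 1)⁻¹ + 1)) hq
  have hK2 : 2 < q ^ K := by
    have : 0 < (q - 1)⁻¹ := inv_pos.2 (by linarith)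
    linarith
  -- The cube of `K` serves two sums: fourth powers of the blocks give `(K d)³ · n d`, and squares
  -- of the pair blocks give `K² d² · n K d²`. Both equal `K³ n d⁴`.
  refine ⟨(K : ℝ) ^ 3, by positivity, fun n hA t ht => ?_⟩
  set A := arrayNorm a n with hAdef
  set d := arrayMax a n
  set J := cubeDim m n
  set s := t / A
  set I := Finset.Icc 1 n
  set B : ℕ → Finset ℕ := fun k => bits (m k)
  set c : ℕ → ℝ := fun k => a k n
  set I' := blockPairs I B
  set B' : ℕ × ℕ → Finset ℕ := fun z => symmDiff (B z.1) (B z.2)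
  set c' : ℕ × ℕ → ℝ := fun z => c z.1 * c z.2
  set X := (K : ℝ) ^ 3 * (n * d ^ 4) with hX
  have hd : 0 ≤ d := arrayMax_nonneg a n
  have hB : ∀ k ∈ I, (B k).Nonempty := fun k hk => hm.bits_nonempty hk
  have hJ : ∀ k ∈ I, lead (B k) < J := fun k hk => lead_lt_cubeDim m hk
  have hc : ∀ k ∈ I, |c k| ≤ d := fun k hk => abs_le_arrayMax a hk
  have hmem : ∀ z ∈ I', z.1 ∈ I ∧ z.2 ∈ I ∧ z.1 ≠ z.2 := fun z hz => by
    simp only [I', blockPairs, Finset.mem_filter, Finset.mem_product] at hz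
    exact ⟨hz.1.1, hz.1.2, hz.2.1⟩
  have hB' : ∀ z ∈ I', (B' z).Nonempty := fun z hz => by
    obtain ⟨h1, h2, h3⟩ := hmem z hz
    rw [Finset.symmDiff_nonempty]
    exact hm.bits_ne hq (Finset.mem_Icc.1 h1).1 (Finset.mem_Icc.1 h2).1 h3
  have hJ' : ∀ z ∈ I', lead (B' z) < J := fun z hz => by
    obtain ⟨h1, h2, -⟩ := hmem z hz
    exact (lead_symmDiff_le _ _).trans_lt (max_lt (hJ _ h1) (hJ _ h2))
  have hc' : ∀ z ∈ I', |c' z| ≤ d ^ 2 := fun z hz => by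
    obtain ⟨h1, h2, -⟩ := hmem z hz
    rw [abs_mul, sq]
    exact mul_le_mul (hc _ h1) (hc _ h2) (abs_nonneg _) hd
  -- The centred quadratic variation is again a martingale transform, now with blocks indexed by the
  -- leading digit of a symmetric difference, so the exponential estimates apply to it.
  have hvar : ∀ u, cubeVar (walshBlock I c B) J u - A ^ 2 = cubeSum (walshBlock I' c' B') J u := by
    intro u
    rw [cubeVar_walshBlock hB hJ, cubeSum_walshBlock hB' hJ', hAdef, arrayNorm_sq,
      add_sub_cancel_left]
  have hβ : ∑ i ∈ Finset.range J, walshBlockNorm I c B i ^ 4 ≤ X := by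
    refine (sum_walshBlockNorm_pow_le hd hJ hc
      (fun i => hm.card_lead_fiber_le hq hK2 n i) 3).trans_eq ?_
    simp only [I, Nat.card_Icc, Nat.add_sub_cancel, hX]
    ring
  have hβ' : ∑ i ∈ Finset.range J, walshBlockNorm I' c' B' i ^ 2 ≤ X := by
    refine (sum_walshBlockNorm_pow_le (by positivity) hJ' hc'
      (fun i => hm.card_symmDiff_fiber_le hq hK n i) 1).trans ?_
    have h1 : (I'.card : ℝ) ≤ n * K := by exact_mod_cast hm.card_blockPairs_le hq hK2 n
    calc _ ≤ (((K * K : ℕ) : ℝ) * d ^ 2) ^ 1 * (n * K * d ^ 2) := by gcongr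
      _ = X := by rw [hX]; push_cast; ring
  have hX0 : 0 ≤ X := by positivity
  have hP := cubePredictable_walshBlock I' c' B'
  have hb' := abs_walshBlock_le I' c' B'
  have h1 := norm_cubeAvg_cexp_sub_le (cubePredictable_walshBlock I c B) (abs_walshBlock_le I c B)
    s (A ^ 2) J
  have h2 := cubeAvg_exp_cubeSum_le hP hb' (s ^ 2 / 2) J
  have h3 := cubeAvg_abs_one_sub_exp_le hP hb' (s ^ 2 / 2) J
  simp_rw [hvar] at h1
  have hy0 : 0 ≤ s ^ 4 * X := by positivity
  have h2' : cubeAvg J (fun u => Real.exp (s ^ 2 / 2 * cubeSum (walshBlock I' c' B') J u)) ≤ 2 := by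
    refine h2.trans ?_
    have : (s ^ 2 / 2) ^ 2 * (∑ i ∈ Finset.range J, walshBlockNorm I' c' B' i ^ 2) / 2 ≤
        s ^ 4 * X / 8 := by
      calc _ ≤ (s ^ 2 / 2) ^ 2 * X / 2 := by gcongr
        _ = _ := by ring
    calc _ ≤ Real.exp (1 / 8) := Real.exp_le_exp.2 (by linarith)
      _ ≤ 1 / (1 - 1 / 8) := Real.exp_bound_div_one_sub_of_interval (by norm_num) (by norm_num)
      _ ≤ 2 := by norm_num
  have h2'' := zero_le_one.trans (one_le_cubeAvg_exp_cubeSum hP (s ^ 2 / 2) J)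
  have h3' : cubeAvg J (fun u => |1 - Real.exp (s ^ 2 / 2 * cubeSum (walshBlock I' c' B') J u)|) ≤
      Real.sqrt (s ^ 4 * X) := by
    refine h3.trans (Real.sqrt_le_sqrt ?_)
    have : 2 * (s ^ 2 / 2) ^ 2 * (∑ i ∈ Finset.range J, walshBlockNorm I' c' B' i ^ 2) ≤
        s ^ 4 * X / 2 := by
      calc _ ≤ 2 * (s ^ 2 / 2) ^ 2 * X := by gcongr
        _ = _ := by ring
    have h4 : Real.exp (s ^ 4 * X / 2) ≤ 1 / (1 - s ^ 4 * X / 2) :=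
      Real.exp_bound_div_one_sub_of_interval (by linarith) (by linarith)
    have h5 : 1 / (1 - s ^ 4 * X / 2) ≤ 1 + s ^ 4 * X := by
      rw [div_le_iff₀ (by linarith)]
      nlinarith
    have h6 := Real.exp_le_exp.2 this
    linarith
  have hsqrt : Real.sqrt (s ^ 4 * X) = s ^ 2 * Real.sqrt X := by
    rw [Real.sqrt_mul (by positivity), show s ^ 4 = (s ^ 2) ^ 2 by ring,
      Real.sqrt_sq (by positivity)]
  -- Since `s⁴ X ≤ 1`, the drift error `4 s⁴ X` is absorbed by the square root coming from the
  -- variance fluctuation.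
  have hle : s ^ 4 * X ≤ Real.sqrt (s ^ 4 * X) :=
    Real.le_sqrt_of_sq_le (by nlinarith)
  have hgauss : charFun (gaussianReal 0 1) t = (Real.exp (-(s ^ 2 / 2 * A ^ 2)) : ℝ) := by
    rw [charFun_gaussianReal_zero_one]
    congr 3
    simp only [s]
    field_simp
  rw [charFun_normalizedWalshLaw hm, hgauss]
  refine h1.trans ?_
  calc _ ≤ 2 * s ^ 4 * X * 2 + Real.sqrt (s ^ 4 * X) := by gcongr
    _ ≤ 5 * Real.sqrt (s ^ 4 * X) := by linarith
    _ = _ := by rw [hsqrt]; ring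

end charFun

/-! ### Choice of parameters and rates. -/

theorem eventually_four_div_mul_exp_le {r : ℝ} (hr : 0 < r) (p : ℝ) :
    ∀ᶠ A : ℝ in atTop, 4 / A ^ r * Real.exp (-((A ^ r) ^ 2 / 4)) ≤ 4 * (1 / A ^ p) := by
  have h := (tendsto_rpow_mul_exp_neg_mul_atTop_nhds_zero (p / (2 * r)) (1 / 4)
    (by norm_num)).comp (tendsto_rpow_atTop (show 0 < 2 * r by linarith))
  filter_upwards [h.eventually_le_const zero_lt_one, eventually_ge_atTop 1] with A hA h1
  have h0 : 0 < A := by linarith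
  simp only [Function.comp_apply] at hA
  rw [← Real.rpow_mul h0.le, mul_div_cancel₀ _ (by positivity)] at hA
  have e : (A ^ r) ^ 2 / 4 = 1 / 4 * A ^ (2 * r) := by
    rw [mul_comm 2 r, Real.rpow_mul h0.le, ← Real.rpow_natCast (A ^ r) 2]
    push_cast
    ring
  rw [e, ← neg_mul]
  have h2 : 1 ≤ A ^ r := Real.one_le_rpow h1 hr.le
  calc _ ≤ 4 * Real.exp (-(1 / 4) * A ^ (2 * r)) := by
        gcongr
        exact div_le_self (by norm_num) h2
    _ ≤ _ := by
        gcongr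
        rw [le_div_iff₀ (by positivity), mul_comm]
        exact hA

theorem exists_forall_le_of_eventually_le {D A : ℕ → ℝ} {p : ℝ} (hD : ∀ n, D n ≤ 1)
    (h : ∃ C : ℝ, ∀ᶠ n in atTop, 0 < A n → D n ≤ C * (1 / A n ^ p)) :
    ∃ C : ℝ, ∀ n, 0 < A n → D n ≤ C * (1 / A n ^ p) := by
  obtain ⟨C, hC⟩ := h
  obtain ⟨N, hN⟩ := eventually_atTop.1 hC
  refine ⟨max C 0 + ∑ k ∈ Finset.range N, |A k ^ p|, fun n hn => ?_⟩
  have hp : 0 < A n ^ p := Real.rpow_pos_of_pos hn p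
  have h0 : 0 ≤ ∑ k ∈ Finset.range N, |A k ^ p| := Finset.sum_nonneg fun _ _ => abs_nonneg _
  rcases lt_or_ge n N with h | h
  · refine (hD n).trans ?_
    rw [mul_one_div, one_le_div hp]
    have := Finset.single_le_sum (f := fun k => |A k ^ p|) (fun _ _ => abs_nonneg _)
      (Finset.mem_range.2 h)
    have h1 := le_abs_self (A n ^ p)
    have h2 := le_max_right C 0
    linarith
  · refine (hN n h hn).trans ?_
    gcongr
    have := le_max_left C 0
    linarith

theorem integrable_abs_cube_mul_exp :
    Integrable fun t : ℝ => |t| ^ 3 * Real.exp (-(t ^ 2 / 2)) := by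
  have h := (integrable_rpow_mul_exp_neg_mul_sq (b := 1 / 2) (by norm_num)
    (s := (3 : ℕ)) (by norm_num)).norm
  refine h.congr (ae_of_all _ fun t => ?_)
  simp only
  rw [Real.rpow_natCast, norm_mul, norm_pow, Real.norm_eq_abs, Real.norm_eq_abs,
    abs_of_pos (Real.exp_pos _)]
  ring_nf

/-- The rate for lacunarity ratio at least `2`. -/
theorem eventually_kolmogorovDist_le_of_two_le {q : ℝ} {m : ℕ → ℕ} {a : ℕ → ℕ → ℝ} (hq : 2 ≤ q)
    (hm : IsLacunary q m) (hA : Tendsto (fun n => arrayNorm a n) atTop atTop) {κ : ℝ}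
    (hκ : Tendsto (fun n : ℕ => ∑ k ∈ Finset.Icc 1 n, a k n ^ 4) atTop (𝓝 κ))
    (hd : Tendsto (fun n : ℕ => (n : ℝ) * arrayMax a n ^ 5) atTop (𝓝 0)) :
    ∃ C : ℝ, ∀ᶠ n in atTop, 0 < arrayNorm a n →
      kolmogorovDist (normalizedWalshLaw a m n) (gaussianReal 0 1) ≤
        C * (1 / arrayNorm a n ^ (6 / 5 : ℝ)) := by
  set G := ∫ t : ℝ, |t| ^ 3 * Real.exp (-(t ^ 2 / 2)) with hG
  have hG0 : 0 ≤ G := integral_nonneg fun t => by positivity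
  refine ⟨4 * (κ + 1) * G + 4 + 6, ?_⟩
  filter_upwards [hA.eventually_ge_atTop 1, hκ.eventually_le_const (lt_add_one κ),
    hd.eventually_le_const zero_lt_one,
    hA.eventually (eventually_four_div_mul_exp_le (show (0 : ℝ) < 7 / 15 by norm_num) (6 / 5))]
    with n h1 hκn hdn htail hA0
  have := isProbabilityMeasure_normalizedWalshLaw a m n
  set A := arrayNorm a n
  set d := arrayMax a n
  have hd0 : 0 ≤ d := arrayMax_nonneg a n
  set M := ∑ k ∈ Finset.Icc 1 n, a k n ^ 4
  have hM0 : 0 ≤ M := Finset.sum_nonneg fun k _ => by positivity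
  -- From `A² ≤ n d²` and `n d⁵ ≤ 1` follows `A² d³ ≤ 1`. This makes `T = A^(5/3)` admissible for
  -- the cosine estimate, which needs `T d ≤ A`.
  have hAd : A ^ (2 / 3 : ℝ) * d ≤ 1 := by
    have h3 : (A ^ (2 / 3 : ℝ) * d) ^ 3 ≤ 1 := by
      rw [mul_pow, ← Real.rpow_natCast (A ^ (2 / 3 : ℝ)) 3, ← Real.rpow_mul hA0.le]
      norm_num
      calc A ^ 2 * d ^ 3 ≤ (n * d ^ 2) * d ^ 3 := by gcongr; exact arrayNorm_sq_le a n
        _ = n * d ^ 5 := by ring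
        _ ≤ 1 := hdn
    exact (pow_le_one_iff_of_nonneg (by positivity) (by norm_num)).1 h3
  have hint : Integrable fun t : ℝ => 4 * M / A ^ 4 * (|t| ^ 3 * Real.exp (-(t ^ 2 / 2))) :=
    integrable_abs_cube_mul_exp.const_mul _
  have key := kolmogorovDist_gaussianReal_le_of_abs_le (normalizedWalshLaw a m n)
    (integrable_id_normalizedWalshLaw a m n) (δ := 1 / A ^ (6 / 5 : ℝ)) (T := A ^ (5 / 3 : ℝ))
    (by positivity) (by positivity) hint (fun t => by positivity) fun t ht => by
      have htd : |t| * d ≤ A := by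
        calc |t| * d ≤ A ^ (5 / 3 : ℝ) * d := by gcongr
          _ = A * (A ^ (2 / 3 : ℝ) * d) := by
            rw [← mul_assoc, show (5 / 3 : ℝ) = 1 + 2 / 3 by norm_num, Real.rpow_add hA0,
              Real.rpow_one]
          _ ≤ A := mul_le_of_le_one_right hA0.le hAd
      refine (norm_charFun_sub_le_of_two_le hq hm a hA0 htd).trans_eq ?_
      rw [abs_neg, neg_sq, div_pow, ← Even.pow_abs (by decide : Even 4) t]
      ring
  have hδT : 1 / A ^ (6 / 5 : ℝ) * A ^ (5 / 3 : ℝ) = A ^ (7 / 15 : ℝ) := by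
    rw [one_div, ← Real.rpow_neg hA0.le, ← Real.rpow_add hA0]
    norm_num
  rw [hδT, integral_const_mul, ← hG] at key
  -- The Fourier integral has order `A⁻⁴`, so the smoothing width `δ = A^(-6/5)` dominates the
  -- bound.
  have hA4 : 1 / A ^ 4 ≤ 1 / A ^ (6 / 5 : ℝ) := by
    gcongr
    rw [← Real.rpow_natCast]
    exact Real.rpow_le_rpow_of_exponent_le h1 (by norm_num)
  calc _ ≤ _ := key
    _ ≤ 4 * (κ + 1) * G * (1 / A ^ (6 / 5 : ℝ)) + 4 * (1 / A ^ (6 / 5 : ℝ)) +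
        6 * (1 / A ^ (6 / 5 : ℝ)) := by
      refine add_le_add (add_le_add ?_ htail) le_rfl
      calc 4 * M / A ^ 4 * G = 4 * M * G * (1 / A ^ 4) := by ring
        _ ≤ 4 * (κ + 1) * G * (1 / A ^ (6 / 5 : ℝ)) := by
          have : 0 ≤ κ + 1 := hM0.trans hκn
          gcongr
    _ = _ := by ring

/-- Multiplying `n d⁴` by `A^(2+8ε) ≤ (n d²)^(1+4ε)` gives `n^(2+4ε) d^(6+8ε)`. This is at most
`(n^(1+ε) d³)^(2+8ε/3)`, as `(1+ε)(2+8ε/3) ≥ 2+4ε`. -/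
theorem natCast_mul_pow_four_le {n : ℕ} {A d ε : ℝ} (hε : 0 < ε) (hA : 0 < A) (hn : 1 ≤ n)
    (hd : 0 ≤ d) (hAd : A ^ 2 ≤ n * d ^ 2) (h : (n : ℝ) ^ (1 + ε) * d ^ 3 ≤ 1) :
    n * d ^ 4 ≤ 1 / A ^ (2 + 8 * ε) := by
  have hn' : (1 : ℝ) ≤ n := by exact_mod_cast hn
  have hn0 : (0 : ℝ) < n := by linarith
  rw [le_div_iff₀ (by positivity)]
  have e1 : A ^ (2 + 8 * ε) = (A ^ 2) ^ (1 + 4 * ε) := by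
    rw [← Real.rpow_natCast A 2, ← Real.rpow_mul hA.le]
    push_cast
    ring_nf
  have hd0 : 0 < d := by
    rcases hd.eq_or_lt with h0 | h0
    · rw [← h0] at hAd
      have : 0 < A ^ 2 := by positivity
      norm_num at hAd
      linarith
    · exact h0
  calc n * d ^ 4 * A ^ (2 + 8 * ε) ≤ n * d ^ 4 * (n * d ^ 2) ^ (1 + 4 * ε) := by
        rw [e1]; gcongr
    _ = (n : ℝ) ^ (2 + 4 * ε) * d ^ (6 + 8 * ε) := by
        rw [Real.mul_rpow hn0.le (by positivity), ← Real.rpow_natCast d 2, ← Real.rpow_mul hd,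
          ← Real.rpow_natCast d 4, show (2 + 4 * ε) = 1 + (1 + 4 * ε) by ring,
          Real.rpow_add hn0 1 (1 + 4 * ε), Real.rpow_one, show 6 + 8 * ε = (4 : ℕ) + (2 : ℕ) * (1 + 4 * ε) by
            push_cast; ring, Real.rpow_add hd0]
        ring
    _ ≤ (n : ℝ) ^ ((1 + ε) * (2 + 8 * ε / 3)) * d ^ (6 + 8 * ε) := by
        gcongr
        nlinarith
    _ = ((n : ℝ) ^ (1 + ε) * d ^ 3) ^ (2 + 8 * ε / 3) := by
        rw [Real.mul_rpow (by positivity) (by positivity), ← Real.rpow_mul hn0.le,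
          ← Real.rpow_natCast d 3, ← Real.rpow_mul hd]
        congr 2
        push_cast
        ring
    _ ≤ 1 := Real.rpow_le_one (by positivity) h (by positivity)

/-- The rate for a general lacunarity ratio. -/
theorem eventually_kolmogorovDist_le {q ε γ : ℝ} {m : ℕ → ℕ} {a : ℕ → ℕ → ℝ} (hq : 1 < q)
    (hm : IsLacunary q m) (hA : Tendsto (fun n => arrayNorm a n) atTop atTop) (hε : 0 < ε)
    (hγ : γ ≤ ε / 3)
    (hd : Tendsto (fun n : ℕ => (n : ℝ) ^ (1 + ε) * arrayMax a n ^ 3) atTop (𝓝 0)) :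
    ∃ C : ℝ, ∀ᶠ n in atTop, 0 < arrayNorm a n →
      kolmogorovDist (normalizedWalshLaw a m n) (gaussianReal 0 1) ≤
        C * (1 / arrayNorm a n ^ (2 * γ + 1)) := by
  obtain ⟨W, hW0, hW⟩ := exists_norm_charFun_sub_le hq hm a
  refine ⟨10 * Real.sqrt W + 4 + 6, ?_⟩
  have hr : 0 < 5 * ε / 3 - 2 * γ := by linarith
  filter_upwards [hA.eventually_ge_atTop (max 1 W), eventually_ge_atTop 1,
    hd.eventually_le_const zero_lt_one,
    hA.eventually (eventually_four_div_mul_exp_le hr (2 * γ + 1))]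
    with n hAn hn hdn htail hA0
  have h1 := (le_max_left _ _).trans hAn
  have hAW := (le_max_right _ _).trans hAn
  have := isProbabilityMeasure_normalizedWalshLaw a m n
  specialize hW n hA0
  set A := arrayNorm a n
  set d := arrayMax a n
  have hd0 : 0 ≤ d := arrayMax_nonneg a n
  have hX := natCast_mul_pow_four_le hε hA0 hn hd0 (arrayNorm_sq_le a n) hdn
  set X := (n : ℝ) * d ^ 4
  have hX0 : 0 ≤ X := by positivity
  -- The exponent balances two demands. The main term `(T/A)² √(n d⁴)` is at most `A^(10ε/3 - 1 -
  -- 4ε) = A^(-1-2ε/3)`, which is within the target because `γ ≤ ε/3`; and `δT = A^(5ε/3 - 2γ)` is a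
  -- positive power of `A`, so the tail is negligible.
  set T := A ^ (1 + 5 * ε / 3) with hT
  have hT0 : 0 < T := by positivity
  set c := 5 * T / A ^ 2 * Real.sqrt (W * X) with hc
  have hc0 : 0 ≤ c := by positivity
  have hTA : T / A = A ^ (5 * ε / 3) := by
    rw [hT, Real.rpow_add hA0, Real.rpow_one]
    field_simp
  -- The constant `W` is absorbed by one power of `A`, as `W ≤ A` for large `n`.
  have hsmall : (T / A) ^ 4 * (W * X) ≤ 1 := by
    rw [hTA, ← Real.rpow_natCast, ← Real.rpow_mul hA0.le]
    calc _ ≤ A ^ (5 * ε / 3 * (4 : ℕ)) * (A * (1 / A ^ (2 + 8 * ε))) := by gcongr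
      _ = A ^ (-(4 * ε / 3) - 1) := by
        rw [one_div, ← Real.rpow_neg hA0.le, mul_comm A, ← Real.rpow_add_one hA0.ne',
          ← Real.rpow_add hA0]
        push_cast
        ring_nf
      _ ≤ 1 := Real.rpow_le_one_of_one_le_of_nonpos h1 (by linarith)
  have hint : Integrable ((Set.Icc (-T) T).indicator fun _ : ℝ => c) :=
    (integrable_indicator_iff measurableSet_Icc).2 (integrableOn_const (by simp))
  have key := kolmogorovDist_gaussianReal_le_of_abs_le (normalizedWalshLaw a m n)
    (integrable_id_normalizedWalshLaw a m n) (δ := 1 / A ^ (2 * γ + 1)) (T := T)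
    (by positivity) hT0 hint (fun t => Set.indicator_nonneg (fun _ _ => hc0) t) fun t ht => by
      have hmem : -t ∈ Set.Icc (-T) T := by
        rw [abs_le] at ht
        constructor <;> linarith [ht.1, ht.2]
      rw [Set.indicator_of_mem hmem]
      refine (hW t ((mul_le_mul_of_nonneg_right ?_ (by positivity)).trans hsmall)).trans ?_
      · rw [← Even.pow_abs (by decide : Even 4), abs_div, abs_of_pos hA0]
        gcongr
      · rw [hc, div_pow, ← sq_abs]
        calc 5 * (|t| ^ 2 / A ^ 2) * Real.sqrt (W * X) =
            |t| * (5 * |t| / A ^ 2 * Real.sqrt (W * X)) := by ring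
          _ ≤ _ := by gcongr
  have hδT : 1 / A ^ (2 * γ + 1) * T = A ^ (5 * ε / 3 - 2 * γ) := by
    rw [one_div, ← Real.rpow_neg hA0.le, hT, ← Real.rpow_add hA0]
    ring_nf
  have hintval : ∫ t, (Set.Icc (-T) T).indicator (fun _ : ℝ => c) t = 2 * T * c := by
    rw [integral_indicator measurableSet_Icc, setIntegral_const, Real.volume_real_Icc_of_le
      (by linarith), smul_eq_mul]
    ring
  rw [hδT, hintval] at key
  have hmain : 2 * T * c ≤ 10 * Real.sqrt W * (1 / A ^ (2 * γ + 1)) := by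
    have hsX : Real.sqrt X ≤ A ^ (-(1 + 4 * ε)) := by
      rw [Real.sqrt_le_left (by positivity)]
      refine hX.trans_eq ?_
      rw [one_div, ← Real.rpow_neg hA0.le, ← Real.rpow_natCast, ← Real.rpow_mul hA0.le]
      push_cast
      ring_nf
    calc 2 * T * c = 10 * Real.sqrt W * ((T / A) ^ 2 * Real.sqrt X) := by
          rw [hc, Real.sqrt_mul hW0]; ring
      _ ≤ 10 * Real.sqrt W * ((T / A) ^ 2 * A ^ (-(1 + 4 * ε))) := by gcongr
      _ ≤ _ := by
        gcongr
        rw [hTA, ← Real.rpow_natCast, ← Real.rpow_mul hA0.le, ← Real.rpow_add hA0, one_div,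
          ← Real.rpow_neg hA0.le]
        refine Real.rpow_le_rpow_of_exponent_le h1 ?_
        push_cast
        linarith
  calc _ ≤ _ := key
    _ ≤ 10 * Real.sqrt W * (1 / A ^ (2 * γ + 1)) + 4 * (1 / A ^ (2 * γ + 1)) +
        6 * (1 / A ^ (2 * γ + 1)) := by gcongr
    _ = _ := by ring

theorem mainTheorem5 (q ε : ℝ) (m : ℕ → ℕ) (a : ℕ → ℕ → ℝ)
    (hq : 1 < q) (hm : IsLacunary q m)
    (hA : Tendsto (fun n => arrayNorm a n) atTop atTop)
    (hlarge : 2 ≤ q →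
      (∃ κ₄ : ℝ, Tendsto (fun n : ℕ => ∑ k ∈ Finset.Icc 1 n, a k n ^ 4) atTop (𝓝 κ₄)) ∧
      Tendsto (fun n : ℕ => (n : ℝ) * arrayMax a n ^ 5) atTop (𝓝 0))
    (hsmall : q < 2 →
      0 < ε ∧ Tendsto (fun n : ℕ => (n : ℝ) ^ (1 + ε) * arrayMax a n ^ 3) atTop (𝓝 0)) :
    ∃ C : ℝ, ∀ n : ℕ, 0 < arrayNorm a n →
      kolmogorovDist (normalizedWalshLaw a m n) (gaussianReal 0 1) ≤
        C * (1 / arrayNorm a n ^ (2 * walshGamma q ε + 1)) := by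
  refine exists_forall_le_of_eventually_le (fun n => ?_) ?_
  · have := isProbabilityMeasure_normalizedWalshLaw a m n
    exact kolmogorovDist_le_one _ _
  rcases le_or_gt 2 q with h2 | h2
  · obtain ⟨⟨κ, hκ⟩, hd⟩ := hlarge h2
    rw [walshGamma, if_pos h2, show (2 * (1 / 10) + 1 : ℝ) = 6 / 5 by norm_num]
    exact eventually_kolmogorovDist_le_of_two_le h2 hm hA hκ hd
  · obtain ⟨hε, hd⟩ := hsmall h2
    rw [walshGamma, if_neg (not_le.2 h2)]
    exact eventually_kolmogorovDist_le hq hm hA hε (min_le_left _ _) hd
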